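/- **Theorem (simulation lower bound in the oracle model).** *Hamiltonians.* Let $n,T\in\mathbb N$, $L=T-1$, and let $\Pi_1,\dots,\Pi_L$ be permutations of $\{0,1\}^n$. The permutation-chain graph has the $2^nT$ vertices $(j,x)$, $j\in\{0,\dots,L\}$, $x\in\{0,1\}^n$, and its edges join $(j,x)$ to $(j+1,\Pi_{j+1}(x))$ for $0\le j<L$. Let $H_\Pi\in\mathbb C^{(2^nT)\times(2^nT)}$ be its adjacency matrix. *Oracles.* Rows and columns are numbered so that $(j,x)$ precedes $(j',x')$ if $j<j'$, or $j=j'$ and $x<x'$. The entry oracle is $O_H|j,k,z\rangle=|j,k,z\oplus H_{jk}\rangle$, where the value $H_{jk}$ is written in any fixed encoding by bit strings. The sparse structure oracle is $O_S|j,s\rangle=|j,k\rangle$, where $k$ is the column of the $s$-th nonzero entry of row $j$; if row $j$ has only $m<s$ nonzero entries, $k$ is the column of its $(s-m)$-th zero entry, so that $O_S$ is unitary. *Algorithms.* A quantum algorithm with $p$-parallel queries acts on the $N$-dimensional system (here $N=2^nT$), $p$ query slots and a finite-dimensional workspace. It alternates arbitrary unitaries, independent of $H$, with rounds; in one round each of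 the $p$ slots makes, in superposition, a query to $O_H$, $O_S$ or $O_S^{-1}$, or none. Its output is the reduced density matrix $\rho$ of the system at the end. It *simulates $H$ for time $t$ with error $\epsilon$ on $|\psi\rangle$* if, started with the system in $|\psi\rangle$, the trace distance of $\rho$ and the pure state $e^{-iHt}|\psi\rangle$ is at most $\epsilon$. Below, $|\psi\rangle=|0,0^n\rangle$: already correctness on this single initial state requires many queries. *Claim.* Every $H_\Pi$ is Hermitian and $2$-sparse (at most $2$ nonzero entries in each row), and all its entries have absolute value at most $1$. There are universal constants $c,t_0>0$ such that for all $T,p:\mathbb N\to\mathbb N$ that are bounded by polynomials the following hold. 1. (Random permutations.) There is a negligible function $\delta$ (that is, $n^k\delta(n)\to0$ for every $k$), depending only on $T$ and $p$, such that for every $n$, every real $t\in[t_0,T(n)/2]$, every $\epsilon\le 1/4$ and every quantum algorithm with fewer than $ct$ rounds of $p(n)$-parallel queries, the probability, over independent uniformly random permutations $\Pi_1,\dots,\Pi_{T(n)-1}$ of $\{0,1\}^n$, that the algorithm simulates $H_\Pi$ for time $t$ with error $\epsilon$ on $|0,0^n\rangle$ is at most $\delta(n)$. 2. (One Hamiltonian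 for all algorithms.) Let a countable collection of algorithms be given (for example, all uniform ones), each of them consisting of circuits $(A_n)_n$ with $p(n)$-parallel queries and evolution times $(t_n)_n$. Then there are permutations $\Pi^{(n)}$, one tuple of length $T(n)-1$ for each $n$, such that for every member of the collection, for all sufficiently large $n$: if $t_n\in[t_0,T(n)/2]$ and $A_n$ simulates $H_{\Pi^{(n)}}$ for time $t_n$ with error at most $1/4$ on $|0,0^n\rangle$, then $A_n$ makes at least $ct_n$ rounds of $p(n)$-parallel queries. -/

import Mathlib

open scoped Matrix

noncomputable section

/-! ### Sparse Hamiltonians and the matrix of the permutation-chain graph -/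

/-- `f n = poly(n)`. -/
def PolyBounded (f : ℕ → ℕ) : Prop :=
  ∃ k : ℕ, ∀ n : ℕ, f n ≤ n ^ k + k

open Classical in
/-- The set of columns of the nonzero entries in row `j`. -/
def rowSupport {N : ℕ} (H : Matrix (Fin N) (Fin N) ℂ) (j : Fin N) : Finset (Fin N) :=
  Finset.univ.filter fun k => H j k ≠ 0

/-- Every row has at most `d` nonzero entries. -/
def IsSparse {N : ℕ} (d : ℕ) (H : Matrix (Fin N) (Fin N) ℂ) : Prop :=
  ∀ j, (rowSupport H j).card ≤ d

/-- `L = T - 1` permutations of the `2 ^ n` bit strings of length `n`; a bit string is identified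
with the number it represents, so `0` stands for `0ⁿ`. The permutation with index `i` (counted
from `0`) leads from column `i` to column `i + 1` of the graph below. -/
abbrev PermChain (n T : ℕ) : Type := Fin (T - 1) → Equiv.Perm (Fin (2 ^ n))

/-- The permutation-chain graph: `T` columns, numbered `0, …, T - 1`, with `2 ^ n` vertices each;
the vertex `(i, x)` is joined to `(i + 1, σ i x)`, and there are no other edges. -/
def chainGraph {n T : ℕ} (σ : PermChain n T) : SimpleGraph (Fin T × Fin (2 ^ n)) :=
  SimpleGraph.fromRel fun u v =>
    ∃ i : Fin (T - 1), (u.1 : ℕ) = i ∧ (v.1 : ℕ) = i + 1 ∧ v.2 = σ i u.2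

open Classical in
/-- The adjacency matrix of the permutation-chain graph. The vertex `(j, x)` is the basis vector
with number `j * 2 ^ n + x`; in particular `(0, 0ⁿ)` has number `0`. -/
def chainHamiltonian {n T : ℕ} (σ : PermChain n T) :
    Matrix (Fin (T * 2 ^ n)) (Fin (T * 2 ^ n)) ℂ :=
  Matrix.reindex finProdFinEquiv finProdFinEquiv ((chainGraph σ).adjMatrix ℂ)

/-! ### The oracles, as permutations of the computational basis -/

/-- The entry oracle `|j, k, z⟩ ↦ |j, k, z ⊕ H j k⟩`, where `enc` is the encoding of
the matrix entries by strings of `b` bits, and `⊕` is bitwise addition modulo `2`. -/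
def entryOracle {N b : ℕ} (enc : ℂ → Fin b → ZMod 2) (H : Matrix (Fin N) (Fin N) ℂ) :
    Equiv.Perm (Fin N × Fin N × (Fin b → ZMod 2)) where
  toFun q := (q.1, q.2.1, q.2.2 + enc (H q.1 q.2.1))
  invFun q := (q.1, q.2.1, q.2.2 - enc (H q.1 q.2.1))
  left_inv q := by simp
  right_inv q := by simp

/-- The enumeration of `Fin N` that lists first the elements of `S` and then those of its
complement, each of the two parts in increasing order. -/
def listFirst {N : ℕ} (S : Finset (Fin N)) : Equiv.Perm (Fin N) :=
  (finCongr (by rw [Finset.card_add_card_compl, Fintype.card_fin])).trans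
    (finSumFinEquiv.symm.trans (finSumEquivOfFinset (s := S) rfl rfl))

/-- The sparse structure oracle `|j, s⟩ ↦ |j, k⟩`, where `k` is the column of the `s`-th nonzero
entry of row `j` (counting `s` from `0`). If row `j` has only `m ≤ s` nonzero entries, then `k` is
the column of its `(s - m)`-th zero entry; this makes the map a unitary. -/
def sparseOracle {N : ℕ} (H : Matrix (Fin N) (Fin N) ℂ) : Equiv.Perm (Fin N × Fin N) where
  toFun q := (q.1, listFirst (rowSupport H q.1) q.2)
  invFun q := (q.1, (listFirst (rowSupport H q.1)).symm q.2)
  left_inv q := by simp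
  right_inv q := by simp

/-- Basis states of one query slot, which is the direct sum of four registers: idle, a query to the
entry oracle (its own inverse), a query to the sparse structure oracle, and a query to the inverse
of the latter. -/
abbrev QuerySlot (N b : ℕ) : Type :=
  Unit ⊕ (Fin N × Fin N × (Fin b → ZMod 2)) ⊕ (Fin N × Fin N) ⊕ (Fin N × Fin N)

set_option synthInstance.maxSize 1000 in
instance instDecidableEqQuerySlot (N b : ℕ) : DecidableEq (QuerySlot N b) :=
  instDecidableEqSum

/-- The action of the oracles on one query slot. -/
def slotOracle {N b : ℕ} (enc : ℂ → Fin b → ZMod 2) (H : Matrix (Fin N) (Fin N) ℂ) :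
    Equiv.Perm (QuerySlot N b) :=
  Equiv.sumCongr (Equiv.refl Unit) (Equiv.sumCongr (entryOracle enc H)
    (Equiv.sumCongr (sparseOracle H) (sparseOracle H).symm))

/-! ### Quantum algorithms with `p`-parallel queries -/

/-- Basis states of the whole memory: the system of dimension `N`, the `p` query slots and a
workspace of dimension `w + 1`. -/
abbrev MemoryBasis (N p b w : ℕ) : Type :=
  Fin N × (Fin p → QuerySlot N b) × Fin (w + 1)

/-- One `p`-parallel query: the oracles act on all the `p` query slots at the same time. -/
def parallelOracle {N b : ℕ} (p w : ℕ) (enc : ℂ → Fin b → ZMod 2)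
    (H : Matrix (Fin N) (Fin N) ℂ) : Equiv.Perm (MemoryBasis N p b w) :=
  Equiv.prodCongr (Equiv.refl (Fin N))
    (Equiv.prodCongr (Equiv.piCongrRight fun _ : Fin p => slotOracle enc H)
      (Equiv.refl (Fin (w + 1))))

/-- A quantum algorithm with `p`-parallel queries: it applies `gate 0`, and then, for
`r = 1, …, rounds`, one `p`-parallel query followed by `gate r`. The gates are arbitrary unitaries
that do not depend on the Hamiltonian (`gate r` with `r > rounds` is ignored). -/
structure QueryAlgorithm (N p b : ℕ) where
  /-- the number of `p`-parallel queries -/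
  rounds : ℕ
  /-- the workspace has dimension `work + 1` -/
  work : ℕ
  /-- the unitaries between the queries -/
  gate : ℕ → Matrix.unitaryGroup (MemoryBasis N p b work) ℂ

namespace QueryAlgorithm

variable {N p b : ℕ} (A : QueryAlgorithm N p b)

/-- The memory at the start: the system is in the state `ψ`, the slots are idle, and the workspace
is in its basis state `0`. -/
def initialState (ψ : Fin N → ℂ) : MemoryBasis N p b A.work → ℂ :=
  fun m => if m.2 = (fun _ => Sum.inl (), 0) then ψ m.1 else 0

/-- The state of the memory after `r` rounds. -/
def stateAfter (enc : ℂ → Fin b → ZMod 2) (H : Matrix (Fin N) (Fin N) ℂ) (ψ : Fin N → ℂ) :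
    ℕ → (MemoryBasis N p b A.work → ℂ)
  | 0 => (A.gate 0 : Matrix _ _ ℂ) *ᵥ A.initialState ψ
  | r + 1 => (A.gate (r + 1) : Matrix _ _ ℂ) *ᵥ
      fun m => stateAfter enc H ψ r ((parallelOracle p A.work enc H).symm m)

/-- The output: the density matrix of the system at the end, with the query slots and the workspace
traced out. -/
def output (enc : ℂ → Fin b → ZMod 2) (H : Matrix (Fin N) (Fin N) ℂ) (ψ : Fin N → ℂ) :
    Matrix (Fin N) (Fin N) ℂ :=
  Matrix.of fun k l => ∑ r : (Fin p → QuerySlot N b) × Fin (A.work + 1),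
    A.stateAfter enc H ψ A.rounds (k, r) * star (A.stateAfter enc H ψ A.rounds (l, r))

end QueryAlgorithm

/-! ### Hamiltonian simulation -/

/-- The trace distance `(1/2) tr √((ρ - τ)† (ρ - τ))`; the trace of the square root is written as
the sum of the square roots of the eigenvalues. -/
def traceDistance {N : ℕ} (ρ τ : Matrix (Fin N) (Fin N) ℂ) : ℝ :=
  (1 / 2) * ∑ i, Real.sqrt
    ((Matrix.isHermitian_conjTranspose_mul_self (ρ - τ)).eigenvalues i)

/-- The ideal state `e^{-iHt} ψ`. -/
def evolve {N : ℕ} (H : Matrix (Fin N) (Fin N) ℂ) (t : ℝ) (ψ : Fin N → ℂ) : Fin N → ℂ :=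
  NormedSpace.exp ((-(Complex.I * (t : ℂ))) • H) *ᵥ ψ

/-- The projection `|φ⟩⟨φ|`. -/
def pureDensity {N : ℕ} (φ : Fin N → ℂ) : Matrix (Fin N) (Fin N) ℂ :=
  Matrix.vecMulVec φ (star φ)

/-- With the oracles of `H`, the algorithm simulates `H` on the initial state `ψ` for time `t` with
error at most `ε` in trace distance. -/
def QueryAlgorithm.SimulatesOn {N p b : ℕ} (A : QueryAlgorithm N p b)
    (enc : ℂ → Fin b → ZMod 2) (H : Matrix (Fin N) (Fin N) ℂ) (ψ : Fin N → ℂ) (t ε : ℝ) : Prop :=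
  traceDistance (A.output enc H ψ) (pureDensity (evolve H t ψ)) ≤ ε

/-- The basis state with number `0`; for the permutation-chain graph this is `|0, 0ⁿ⟩`. -/
def zeroState (N : ℕ) : Fin N → ℂ := fun k => if (k : ℕ) = 0 then 1 else 0

open Classical in
/-- The probability of an event under the uniform distribution on a finite type. -/
def uniformProb {α : Type} [Fintype α] (E : α → Prop) : ℝ :=
  ((Finset.univ.filter E).card : ℝ) / (Fintype.card α : ℝ)

end

/-!
The theorem combines two facts about the path that starts in the vertex `(0, 0ⁿ)` of the
permutation-chain graph.

*The evolution moves along the path at constant speed.* Up to phases, the amplitudes on the path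
are real numbers that solve `w x' = w (x - 1) - w (x + 1)` with zero boundary values. The mean
position `∑ x (w x)²` is accelerated by the left end, at the rate `2 (w 1)²`, and slowed down by
the right end, at the rate `2 (w T)²` (`IsPathWalk.hasDerivAt_velocity`). The left end alone
provides a velocity of at least `1.22`, and exponential weights show that the right end is not felt
before the time `0.48 T` (`IsPathWalk.w_right_sq_le`), so that the mean position at a time `t ≤ T /
2` is at least about `1.09 t`. Since the second moment is at most `(1 + 2 t)²`, the inequality of
Cauchy and Schwarz gives a probability of at least `0.27` for the columns beyond `t / 100`
(`prob_pathBeyond_ge`).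

*An algorithm moves along the path by one vertex per round.* A uniformly random chain is obtained
from a uniformly random chain `B` and independent random targets `x` by composing each permutation
of `B` with a transposition, so that the path runs through the targets (`redirect`,
`sum_redirect`). If only the first `r` permutations are redirected, then the chain does not depend
on the later targets. In the hybrid run, the round `r` uses the oracles of this chain
(`revealState`). The rows of the Hamiltonian that differ from the true ones are determined by
single targets that are independent of the state before this round, and so each row differs with
probability at most `3 / 2ⁿ` (`sum_row_ne_le`). Hence replacing the oracles changes the final state
very little, and the final state of the hybrid run has weight at most `2⁻ⁿ` on the rest of the
path. Therefore an algorithm with `q` rounds ends beyond the column `q` with an average probability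
of the order of `p q² / 2ⁿ` (`QueryAlgorithm.sum_prob_beyond_le`).

Measuring the position distinguishes the two states at most as well as their trace distance allows
(`norm_sum_diag_le_traceDistance`), so that a simulation with error `1 / 4` ends beyond the column
`t / 100` with probability at least `0.27 - 0.25`. By Markov's inequality, an algorithm with fewer
than `t / 100` rounds achieves this only for a negligible fraction of the chains. For countably
many algorithms, the union bound over the first `n` of them provides a chain that is bad for all of
these, for each large `n`.
-/

noncomputable section

/-! ### The discrete transport equation on a path -/

/-- Comparison of two differentiable functions through their derivatives. -/
theorem le_of_hasDerivAt_le {f g f' g' : ℝ → ℝ} {a b : ℝ} (hab : a ≤ b)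
    (hf : ∀ s, HasDerivAt f (f' s) s) (hg : ∀ s, HasDerivAt g (g' s) s)
    (hle : ∀ s, a ≤ s → s ≤ b → f' s ≤ g' s) (h0 : f a ≤ g a) : f b ≤ g b := by
  have hanti : MonotoneOn (fun s => g s - f s) (Set.Icc a b) := by
    refine monotoneOn_of_deriv_nonneg (convex_Icc a b) ?_ ?_ ?_
    · exact fun s _ => ((hg s).sub (hf s)).continuousAt.continuousWithinAt
    · exact fun s _ => ((hg s).sub (hf s)).differentiableAt.differentiableWithinAt
    · intro s hs
      rw [interior_Icc] at hs
      have hd : deriv (fun s => g s - f s) s = g' s - f' s := ((hg s).sub (hf s)).deriv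
      rw [hd]
      linarith [hle s hs.1.le hs.2.le]
  have := hanti (Set.left_mem_Icc.2 hab) (Set.right_mem_Icc.2 hab) hab
  simp only at this
  linarith

/-- A real solution of `w x' = w (x - 1) - w (x + 1)` on the sites `1, …, T` that vanishes at the
sites `0` and `T + 1` and starts as the unit vector at the site `1`. Up to phases, this is
the evolution of a quantum walk on a path with `T` vertices that starts at an end. -/
structure IsPathWalk (T : ℕ) (w : ℕ → ℝ → ℝ) : Prop where
  left : ∀ s, w 0 s = 0
  right : ∀ s, w (T + 1) s = 0
  deriv : ∀ x < T, ∀ s, HasDerivAt (w (x + 1)) (w x s - w (x + 2) s) s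
  start : w 1 0 = 1
  start' : ∀ x, 0 < x → x < T → w (x + 1) 0 = 0

/-- The mean of the weight `f` in the distribution `w²`; the site `x + 1` has the weight `f x`. -/
def pathMean (T : ℕ) (w : ℕ → ℝ → ℝ) (f : ℕ → ℝ) (s : ℝ) : ℝ :=
  ∑ x ∈ Finset.range T, f x * w (x + 1) s ^ 2

/-- The mean velocity. -/
def pathVelocity (T : ℕ) (w : ℕ → ℝ → ℝ) (s : ℝ) : ℝ :=
  2 * ∑ x ∈ Finset.range T, w (x + 1) s * w (x + 2) s

theorem sum_weight_telescope (f w : ℕ → ℝ) (n : ℕ) :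
    ∑ x ∈ Finset.range n, f x * (2 * w (x + 1) * (w x - w (x + 2))) =
      ∑ x ∈ Finset.range n, 2 * (f (x + 1) - f x) * (w (x + 1) * w (x + 2)) +
        2 * f 0 * w 0 * w 1 - 2 * f n * w n * w (n + 1) := by
  induction n with
  | zero => simp
  | succ n ih => rw [Finset.sum_range_succ, Finset.sum_range_succ, ih]; ring

theorem sum_velocity_telescope (w : ℕ → ℝ) (n : ℕ) :
    ∑ x ∈ Finset.range n, ((w x - w (x + 2)) * w (x + 2) + w (x + 1) * (w (x + 1) - w (x + 3))) =
      w 1 ^ 2 - w (n + 1) ^ 2 + w 0 * w 2 - w n * w (n + 2) := by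
  induction n with
  | zero => simp
  | succ n ih => rw [Finset.sum_range_succ, ih]; ring

namespace IsPathWalk

variable {T : ℕ} {w : ℕ → ℝ → ℝ}

theorem hasDerivAt_pathMean (h : IsPathWalk T w) (f : ℕ → ℝ) (s : ℝ) :
    HasDerivAt (pathMean T w f)
      (∑ x ∈ Finset.range T, 2 * (f (x + 1) - f x) * (w (x + 1) s * w (x + 2) s)) s := by
  have h1 : HasDerivAt (pathMean T w f)
      (∑ x ∈ Finset.range T, f x * (2 * w (x + 1) s * (w x s - w (x + 2) s))) s := by
    unfold pathMean
    refine HasDerivAt.fun_sum fun x hx => ?_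
    have := ((h.deriv x (Finset.mem_range.1 hx) s).pow 2).const_mul (f x)
    simpa using this
  rw [sum_weight_telescope f (fun x => w x s) T] at h1
  simpa [h.left s, h.right s] using h1

theorem pathMean_zero (h : IsPathWalk T w) (hT : 0 < T) (f : ℕ → ℝ) :
    pathMean T w f 0 = f 0 := by
  unfold pathMean
  rw [Finset.sum_eq_single_of_mem 0 (Finset.mem_range.2 hT)]
  · simp [h.start]
  · intro x hx hx0
    rw [h.start' x (Nat.pos_of_ne_zero hx0) (Finset.mem_range.1 hx)]
    simp

theorem sum_sq_eq_one (h : IsPathWalk T w) (hT : 0 < T) (s : ℝ) :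
    ∑ x ∈ Finset.range T, w (x + 1) s ^ 2 = 1 := by
  have hc : pathMean T w (fun _ => 1) s = pathMean T w (fun _ => 1) 0 := by
    refine is_const_of_deriv_eq_zero (fun s => (h.hasDerivAt_pathMean _ s).differentiableAt)
      (fun s => ?_) s 0
    rw [(h.hasDerivAt_pathMean _ s).deriv]
    simp
  rw [h.pathMean_zero hT] at hc
  simpa [pathMean] using hc

/-- Shifting the summation by one site loses the term `w 1` and gains `w (T + 1) = 0`. -/
theorem sum_shift_le (h : IsPathWalk T w) {f : ℕ → ℝ} (hf : 0 ≤ f 0) (s : ℝ) :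
    ∑ x ∈ Finset.range T, f (x + 1) * w (x + 2) s ^ 2 ≤ pathMean T w f s := by
  have h1 := Finset.sum_range_succ (fun x => f x * w (x + 1) s ^ 2) T
  rw [Finset.sum_range_succ', h.right s] at h1
  unfold pathMean
  nlinarith [mul_nonneg hf (sq_nonneg (w (0 + 1) s))]

theorem neg_two_le_velocity (h : IsPathWalk T w) (hT : 0 < T) (s : ℝ) :
    -2 ≤ pathVelocity T w s := by
  have h1 := h.sum_sq_eq_one hT s
  have h2 := h.sum_shift_le (f := fun _ => 1) zero_le_one s
  simp only [pathMean, one_mul] at h2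
  have h3 : 0 ≤ ∑ x ∈ Finset.range T, (w (x + 1) s + w (x + 2) s) ^ 2 :=
    Finset.sum_nonneg fun _ _ => sq_nonneg _
  have h4 : ∑ x ∈ Finset.range T, (w (x + 1) s + w (x + 2) s) ^ 2 =
      ∑ x ∈ Finset.range T, w (x + 1) s ^ 2 + ∑ x ∈ Finset.range T, w (x + 2) s ^ 2 +
        pathVelocity T w s := by
    rw [pathVelocity, Finset.mul_sum, ← Finset.sum_add_distrib, ← Finset.sum_add_distrib]
    exact Finset.sum_congr rfl fun _ _ => by ring
  linarith

/-- The position is the integral of the velocity. -/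
theorem hasDerivAt_position (h : IsPathWalk T w) (s : ℝ) :
    HasDerivAt (pathMean T w fun x => (x : ℝ) + 1) (pathVelocity T w s) s := by
  convert h.hasDerivAt_pathMean (fun x => (x : ℝ) + 1) s using 1
  rw [pathVelocity, Finset.mul_sum]
  exact Finset.sum_congr rfl fun x _ => by push_cast; ring

/-- The walk is accelerated by the left end of the path, and slowed down by the right end. -/
theorem hasDerivAt_velocity (h : IsPathWalk T w) (hT : 0 < T) (s : ℝ) :
    HasDerivAt (pathVelocity T w) (2 * (w 1 s ^ 2 - w T s ^ 2)) s := by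
  obtain ⟨L, rfl⟩ : ∃ L, T = L + 1 := ⟨T - 1, by omega⟩
  have he : pathVelocity (L + 1) w =
      fun s => 2 * ∑ x ∈ Finset.range L, w (x + 1) s * w (x + 2) s := by
    funext s
    rw [pathVelocity, Finset.sum_range_succ, h.right s]
    simp
  rw [he]
  have h1 : HasDerivAt (fun s => ∑ x ∈ Finset.range L, w (x + 1) s * w (x + 2) s)
      (∑ x ∈ Finset.range L, ((w x s - w (x + 2) s) * w (x + 2) s +
        w (x + 1) s * (w (x + 1) s - w (x + 3) s))) s := by
    refine HasDerivAt.fun_sum fun x hx => ?_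
    have hx := Finset.mem_range.1 hx
    exact (h.deriv x (by omega) s).mul (h.deriv (x + 1) (by omega) s)
  rw [sum_velocity_telescope (fun x => w x s) L] at h1
  have hr : w (L + 2) s = 0 := h.right s
  simp only [h.left s, hr, zero_mul, mul_zero, add_zero, sub_zero] at h1
  exact h1.const_mul 2

theorem sq_add_sq_le_one (h : IsPathWalk T w) (hT : 3 ≤ T) (s : ℝ) :
    w 1 s ^ 2 + w 2 s ^ 2 + w 3 s ^ 2 ≤ 1 := by
  rw [← h.sum_sq_eq_one (by omega) s]
  have := Finset.sum_le_sum_of_subset_of_nonneg (s := Finset.range 3) (t := Finset.range T)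
    (f := fun x => w (x + 1) s ^ 2) (Finset.range_subset_range.2 hT)
    (fun _ _ _ => sq_nonneg _)
  simpa [Finset.sum_range_succ] using this

/-- The constant only has to exceed `√2`, which bounds `w 1 - w 3`. -/
theorem w_two_le (h : IsPathWalk T w) (hT : 3 ≤ T) {s : ℝ} (hs : 0 ≤ s) :
    w 2 s ≤ 3 / 2 * s := by
  refine le_of_hasDerivAt_le (f' := fun s => w 1 s - w 3 s) (g := fun s => 3 / 2 * s)
    (g' := fun _ => 3 / 2) hs
    (fun s => h.deriv 1 (by omega) s) (fun s => ?_) (fun s _ _ => ?_) ?_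
  · simpa using (hasDerivAt_id s).const_mul (3 / 2 : ℝ)
  · have := h.sq_add_sq_le_one hT s
    nlinarith [sq_nonneg (w 1 s + w 3 s), sq_nonneg (w 2 s)]
  · simpa using (h.start' 1 one_pos (by omega)).le

theorem le_w_one (h : IsPathWalk T w) (hT : 3 ≤ T) {s : ℝ} (hs : 0 ≤ s) :
    1 - 3 / 4 * s ^ 2 ≤ w 1 s := by
  refine le_of_hasDerivAt_le (f := fun s => 1 - 3 / 4 * s ^ 2) (f' := fun s => -(3 / 2 * s))
    (g' := fun s => w 0 s - w 2 s) hs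
    (fun s => ?_) (fun s => h.deriv 0 (by omega) s) (fun s hs _ => ?_) ?_
  · refine (((hasDerivAt_pow 2 s).const_mul (3 / 4 : ℝ)).const_sub 1).congr_deriv ?_
    norm_num; ring
  · simp only [h.left s]
    linarith [h.w_two_le hT hs]
  · simp [h.start]

/-- Exponential weights bound the part of the walk that has reached the right end. -/
theorem w_right_sq_le (h : IsPathWalk T w) (hT : 0 < T) {s : ℝ} (hs : 0 ≤ s) :
    (25 / 16 : ℝ) ^ (T - 1) * w T s ^ 2 ≤ Real.exp (9 / 10 * s) := by
  set f : ℕ → ℝ := fun x => (25 / 16 : ℝ) ^ x with hf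
  have hG : pathMean T w f s * Real.exp (-(9 / 10 * s)) ≤ 1 := by
    refine le_of_hasDerivAt_le (a := 0)
      (f := fun s => pathMean T w f s * Real.exp (-(9 / 10 * s))) (g := fun _ => 1)
      (g' := fun _ => 0) hs
      (fun s => (h.hasDerivAt_pathMean f s).mul
        (((hasDerivAt_id s).const_mul (9 / 10 : ℝ)).neg.exp))
      (fun s => hasDerivAt_const s 1) (fun s _ _ => ?_) ?_
    · have h2 : ∑ x ∈ Finset.range T, 2 * (f (x + 1) - f x) * (w (x + 1) s * w (x + 2) s) ≤
          9 / 10 * pathMean T w f s := by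
        have h3 := h.sum_shift_le (f := f) (by positivity) s
        -- by the inequality of the means, with `25 / 16 = (5 / 4) ^ 2`
        have h4 : ∑ x ∈ Finset.range T, 2 * (f (x + 1) - f x) * (w (x + 1) s * w (x + 2) s) ≤
            ∑ x ∈ Finset.range T, 9 / 20 *
              (f x * w (x + 1) s ^ 2 + f (x + 1) * w (x + 2) s ^ 2) := by
          refine Finset.sum_le_sum fun x _ => ?_
          have hp : f (x + 1) = 25 / 16 * f x := by simp only [hf]; rw [pow_succ]; ring
          have hq : 0 ≤ f x := by positivity
          rw [hp]
          nlinarith [mul_nonneg hq (sq_nonneg (w (x + 1) s - 5 / 4 * w (x + 2) s))]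
        rw [← Finset.mul_sum, Finset.sum_add_distrib] at h4
        unfold pathMean at h3 ⊢
        linarith
      have h5 := Real.exp_pos (-(9 / 10 * s))
      simp only [id, mul_one, Pi.neg_apply]
      nlinarith [mul_le_mul_of_nonneg_right h2 h5.le]
    · simp [h.pathMean_zero hT, hf]
  have h1 : f (T - 1) * w T s ^ 2 ≤ pathMean T w f s := by
    have := Finset.single_le_sum (f := fun x => f x * w (x + 1) s ^ 2)
      (fun x _ => by positivity) (Finset.mem_range.2 (Nat.sub_lt hT one_pos))
    rw [show T - 1 + 1 = T by omega] at this
    exact this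
  rw [Real.exp_neg, ← div_eq_mul_inv, div_le_one (Real.exp_pos _)] at hG
  exact h1.trans hG

/-- The second moment grows at most with the maximal velocity `2`. -/
theorem second_moment_le (h : IsPathWalk T w) (hT : 0 < T) {s : ℝ} (hs : 0 ≤ s) :
    pathMean T w (fun x => ((x : ℝ) + 1) ^ 2) s ≤ (1 + 2 * s) ^ 2 := by
  set g := pathMean T w (fun x => ((x : ℝ) + 1) ^ 2) with hg
  have hpos : ∀ s, 1 ≤ g s := fun s => by
    rw [← h.sum_sq_eq_one hT s, hg, pathMean]
    refine Finset.sum_le_sum fun x _ => ?_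
    have : (0 : ℝ) ≤ x := Nat.cast_nonneg x
    nlinarith [sq_nonneg (w (x + 1) s), mul_nonneg this (sq_nonneg (w (x + 1) s)),
      mul_nonneg (mul_nonneg this this) (sq_nonneg (w (x + 1) s))]
  have hb : ∀ s, ∑ x ∈ Finset.range T, 2 * (((x + 1 : ℕ) + 1 : ℝ) ^ 2 - ((x : ℝ) + 1) ^ 2) *
      (w (x + 1) s * w (x + 2) s) ≤ 4 * √(g s) := fun s => by
    have h1 := h.sum_sq_eq_one hT s
    have h2 := h.sum_shift_le (f := fun _ => 1) zero_le_one s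
    simp only [pathMean, one_mul] at h2
    rw [h1] at h2
    have h3 := h.sum_shift_le (f := fun x => ((x : ℝ) + 1) ^ 2) (by positivity) s
    have e1 : ∑ x ∈ Finset.range T, (((x : ℝ) + 1) * w (x + 1) s) * w (x + 2) s ≤ √(g s) := by
      refine (Real.sum_mul_le_sqrt_mul_sqrt _ _ _).trans ?_
      have : ∑ x ∈ Finset.range T, (((x : ℝ) + 1) * w (x + 1) s) ^ 2 = g s :=
        Finset.sum_congr rfl fun _ _ => by ring
      rw [this]
      exact mul_le_of_le_one_right (Real.sqrt_nonneg _) (Real.sqrt_le_one.2 h2)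
    have e2 : ∑ x ∈ Finset.range T, w (x + 1) s * ((((x + 1 : ℕ) : ℝ) + 1) * w (x + 2) s) ≤
        √(g s) := by
      refine (Real.sum_mul_le_sqrt_mul_sqrt _ _ _).trans ?_
      rw [h1, Real.sqrt_one, one_mul]
      refine Real.sqrt_le_sqrt (le_trans (le_of_eq ?_) h3)
      exact Finset.sum_congr rfl fun _ _ => by ring
    calc _ = 2 * ∑ x ∈ Finset.range T, (((x : ℝ) + 1) * w (x + 1) s) * w (x + 2) s +
          2 * ∑ x ∈ Finset.range T, w (x + 1) s * ((((x + 1 : ℕ) : ℝ) + 1) * w (x + 2) s) := by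
            rw [Finset.mul_sum, Finset.mul_sum, ← Finset.sum_add_distrib]
            exact Finset.sum_congr rfl fun _ _ => by push_cast; ring
      _ ≤ _ := by linarith
  have hsq : √(g s) ≤ 1 + 2 * s := by
    refine le_of_hasDerivAt_le (a := 0) (f := fun s => √(g s)) (g := fun s => 1 + 2 * s)
      (g' := fun _ => 2) hs
      (fun s => (h.hasDerivAt_pathMean (fun x => ((x : ℝ) + 1) ^ 2) s).sqrt
        (by have := hpos s; rw [hg] at this; linarith))
      (fun s => ?_) (fun s _ _ => ?_) ?_
    · simpa using ((hasDerivAt_id s).const_mul (2 : ℝ)).const_add 1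
    · have h1 : 0 < √(g s) := Real.sqrt_pos.2 (by linarith [hpos s])
      rw [div_le_iff₀ (by positivity)]
      linarith [hb s]
    · simp [hg, h.pathMean_zero hT]
  have h0 : 0 ≤ √(g s) := Real.sqrt_nonneg _
  rw [← Real.sq_sqrt (zero_le_one.trans (hpos s))]
  gcongr

/-- The wall at the right end is not felt up to the time `0.96 t ≤ 0.48 T`. -/
theorem w_right_sq_small (h : IsPathWalk T w) {t : ℝ} (ht : 100000 ≤ t) (hT : 2 * t ≤ T) :
    ((25 / 16 : ℝ) ^ (T - 1))⁻¹ * Real.exp (9 / 10 * (24 / 25 * t)) ≤ 1 / 1000 := by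
  have hT0 : 0 < T := by
    rcases Nat.eq_zero_or_pos T with h0 | h0
    · rw [h0] at hT; norm_num at hT; linarith
    · exact h0
  -- the decay comes from `exp (0.9 * 0.48) = exp (54 / 125) < 25 / 16`
  have he : Real.exp (54 / 125) ≤ 31 / 20 := by
    have h1 : Real.exp (54 / 125) ^ 125 = Real.exp 1 ^ 54 := by
      rw [← Real.exp_nat_mul, ← Real.exp_nat_mul]; norm_num
    have h2 : Real.exp 1 ^ 54 ≤ (31 / 20 : ℝ) ^ 125 := by
      calc Real.exp 1 ^ 54 ≤ (2.7182818286 : ℝ) ^ 54 := by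
            gcongr; exact Real.exp_one_lt_d9.le
        _ ≤ _ := by norm_num
    rw [← h1] at h2
    exact le_of_pow_le_pow_left₀ (by norm_num) (by norm_num) h2
  have h1 : Real.exp (9 / 10 * (24 / 25 * t)) ≤ (31 / 20 : ℝ) ^ T := by
    calc Real.exp (9 / 10 * (24 / 25 * t)) ≤ Real.exp (T * (54 / 125)) := by
          rw [Real.exp_le_exp]; linarith
      _ = Real.exp (54 / 125) ^ T := by rw [Real.exp_nat_mul]
      _ ≤ _ := by gcongr
  have h2 : (1 : ℝ) + T * (1 / 124) ≤ (1 + 1 / 124) ^ T :=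
    one_add_mul_le_pow (by norm_num) T
  have h3 : (25 / 16 : ℝ) ^ (T - 1) = 16 / 25 * ((1 + 1 / 124) ^ T * (31 / 20) ^ T) := by
    rw [← mul_pow]
    obtain ⟨L, rfl⟩ : ∃ L, T = L + 1 := ⟨T - 1, by omega⟩
    rw [pow_succ, Nat.add_sub_cancel]
    norm_num
    ring
  rw [inv_mul_le_iff₀ (by positivity), h3]
  have h4 : (0 : ℝ) < (31 / 20 : ℝ) ^ T := by positivity
  have h5 : (1600 : ℝ) ≤ (1 + 1 / 124) ^ T := by linarith
  nlinarith [mul_le_mul_of_nonneg_right h5 h4.le]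

/-- Until about the time `2 / √3 ≈ 1.15`, the acceleration is at least `2 (1 - 3 s² / 4)²`,
whose integral is about `1.23`; after that only the right end can slow the walk down. -/
theorem le_velocity (h : IsPathWalk T w) {t : ℝ} (ht : 100000 ≤ t) (hT : 2 * t ≤ T) {s : ℝ}
    (hs : 23 / 20 ≤ s) (hst : s ≤ 24 / 25 * t) : 61 / 50 ≤ pathVelocity T w s := by
  have hT3 : 3 ≤ T := by
    have : (3 : ℝ) ≤ T := by linarith
    exact_mod_cast this
  set K : ℝ := ((25 / 16 : ℝ) ^ (T - 1))⁻¹ with hK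
  -- `K * exp (9 s / 10)` bounds `w T ^ 2`, and its integral is added to the velocity below
  have hK0 : 0 < K := by positivity
  have hwall : ∀ s, 0 ≤ s → w T s ^ 2 ≤ K * Real.exp (9 / 10 * s) := fun s hs => by
    rw [hK, inv_mul_eq_div, le_div_iff₀ (by positivity), mul_comm]
    exact h.w_right_sq_le (by omega) hs
  have hexp : ∀ s, HasDerivAt (fun s => 20 / 9 * K * Real.exp (9 / 10 * s))
      (2 * K * Real.exp (9 / 10 * s)) s := fun s => by
    refine ((((hasDerivAt_id s).const_mul (9 / 10 : ℝ)).exp).const_mul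
      (20 / 9 * K)).congr_deriv ?_
    simp only [id]; ring
  have h1 : 123 / 100 ≤ pathVelocity T w (23 / 20) +
      20 / 9 * K * Real.exp (9 / 10 * (23 / 20)) := by
    have h2 := le_of_hasDerivAt_le (a := 0) (b := 23 / 20)
      (f := fun s => 2 * s - s ^ 3 + 9 / 40 * s ^ 5)
      (f' := fun s => 2 * (1 - 3 / 4 * s ^ 2) ^ 2)
      (g := fun s => pathVelocity T w s + 20 / 9 * K * Real.exp (9 / 10 * s)) (by norm_num)
      (fun s => by
        refine ((((hasDerivAt_id s).const_mul 2).sub (hasDerivAt_pow 3 s)).add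
          ((hasDerivAt_pow 5 s).const_mul (9 / 40 : ℝ))).congr_deriv ?_
        norm_num; ring)
      (fun s => (h.hasDerivAt_velocity (by omega) s).add (hexp s))
      (fun s hs hs' => by
        have h3 := h.le_w_one hT3 hs
        have h4 : 0 ≤ 1 - 3 / 4 * s ^ 2 := by nlinarith
        have h5 := pow_le_pow_left₀ h4 h3 2
        linarith [hwall s hs])
      (by
        have h3 : 0 ≤ pathVelocity T w 0 := by
          rw [pathVelocity]
          refine mul_nonneg zero_le_two (Finset.sum_nonneg fun x hx => le_of_eq ?_)
          rcases Nat.lt_or_ge (x + 1) T with h' | h'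
          · rw [h.start' (x + 1) (by omega) h', mul_zero]
          · have : x + 2 = T + 1 := by have := Finset.mem_range.1 hx; omega
            rw [this, h.right, mul_zero]
        have : 0 ≤ 20 / 9 * K * Real.exp (9 / 10 * 0) := by positivity
        norm_num at this ⊢
        linarith)
    norm_num at h2 ⊢
    linarith
  have h2 := le_of_hasDerivAt_le (a := 23 / 20) (b := s) (f := fun _ => 123 / 100)
    (f' := fun _ => 0) (g := fun s => pathVelocity T w s + 20 / 9 * K * Real.exp (9 / 10 * s))
    hs (fun s => hasDerivAt_const _ _)
    (fun s => (h.hasDerivAt_velocity (by omega) s).add (hexp s))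
    (fun s hs hs' => by
      linarith [hwall s (by linarith), sq_nonneg (w 1 s)]) h1
  have h3 : K * Real.exp (9 / 10 * s) ≤ K * Real.exp (9 / 10 * (24 / 25 * t)) := by gcongr
  have h4 := h.w_right_sq_small ht hT
  linarith

/-- The velocity is at least `1.22` up to the time `0.96 t`, and at least `-2` after it, when the
right end may be reached. -/
theorem le_position (h : IsPathWalk T w) {t : ℝ} (ht : 100000 ≤ t) (hT : 2 * t ≤ T) :
    109 / 100 * t - 3 / 2 ≤ pathMean T w (fun x => (x : ℝ) + 1) t := by
  have hT0 : 0 < T := by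
    have : (0 : ℝ) < T := by linarith
    exact_mod_cast this
  have hlin : ∀ v a s : ℝ, HasDerivAt (fun s => v * (s - a)) v s := fun v a s => by
    simpa using ((hasDerivAt_id s).sub_const a).const_mul v
  have h1 := le_of_hasDerivAt_le (a := 23 / 20) (b := 24 / 25 * t)
    (f' := fun _ => 61 / 50) (by linarith) (hlin (61 / 50) (23 / 20)) h.hasDerivAt_position
    (fun s hs hs' => h.le_velocity ht hT hs hs')
    (by
      simp only [sub_self, mul_zero]
      exact Finset.sum_nonneg fun x _ => by positivity)
  have h2 := le_of_hasDerivAt_le (a := 24 / 25 * t) (b := t)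
    (f := fun s => -2 * (s - 24 / 25 * t) + 61 / 50 * (24 / 25 * t - 23 / 20))
    (f' := fun _ => -2) (by linarith) (fun s => (hlin _ _ s).add_const _) h.hasDerivAt_position
    (fun s _ _ => h.neg_two_le_velocity hT0 s)
    (by simpa using h1)
  linarith

/-- The walk has left the first `t / 100` sites with a probability bounded away from `1 / 4`: its
mean position is at least about `1.09 t`, and the root of its second moment is at most about
`2 t`. -/
theorem tail_prob_ge (h : IsPathWalk T w) {t : ℝ} (ht : 100000 ≤ t) (hT : 2 * t ≤ T) {q : ℕ}
    (hq : (q : ℝ) < 1 / 100 * t) :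
    27 / 100 ≤ ∑ x ∈ Finset.range T with q < x, w (x + 1) t ^ 2 := by
  have hT0 : 0 < T := by
    have : (0 : ℝ) < T := by linarith
    exact_mod_cast this
  have hpos := h.le_position ht hT
  have hmom := h.second_moment_le hT0 (show 0 ≤ t by linarith)
  have hone := h.sum_sq_eq_one hT0 t
  set P := ∑ x ∈ Finset.range T with q < x, w (x + 1) t ^ 2 with hP
  set E := ∑ x ∈ Finset.range T with q < x, ((x : ℝ) + 1) * w (x + 1) t ^ 2 with hE
  have h1 : pathMean T w (fun x => (x : ℝ) + 1) t ≤ E + (q + 1) := by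
    rw [pathMean, ← Finset.sum_filter_add_sum_filter_not _ (fun x => q < x)]
    gcongr
    calc ∑ x ∈ Finset.range T with ¬ q < x, ((x : ℝ) + 1) * w (x + 1) t ^ 2
        ≤ ∑ x ∈ Finset.range T with ¬ q < x, ((q : ℝ) + 1) * w (x + 1) t ^ 2 := by
          refine Finset.sum_le_sum fun x hx => ?_
          have : (x : ℝ) ≤ q := by
            exact_mod_cast not_lt.1 (Finset.mem_filter.1 hx).2
          gcongr
      _ ≤ ∑ x ∈ Finset.range T, ((q : ℝ) + 1) * w (x + 1) t ^ 2 :=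
          Finset.sum_le_sum_of_subset_of_nonneg (Finset.filter_subset _ _)
            fun _ _ _ => by positivity
      _ = (q : ℝ) + 1 := by rw [← Finset.mul_sum, hone, mul_one]
  have hP0 : 0 ≤ P := Finset.sum_nonneg fun _ _ => sq_nonneg _
  have h2 : E ^ 2 ≤ P * (1 + 2 * t) ^ 2 := by
    have h3 := Finset.sum_mul_sq_le_sq_mul_sq (Finset.filter (fun x => q < x) (Finset.range T))
      (fun x => w (x + 1) t) (fun x => ((x : ℝ) + 1) * w (x + 1) t)
    have h4 : ∑ x ∈ Finset.range T with q < x, (((x : ℝ) + 1) * w (x + 1) t) ^ 2 ≤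
        (1 + 2 * t) ^ 2 := by
      refine le_trans ?_ hmom
      refine le_trans (Finset.sum_le_sum_of_subset_of_nonneg (Finset.filter_subset _ _)
        fun _ _ _ => sq_nonneg _) (le_of_eq ?_)
      exact Finset.sum_congr rfl fun _ _ => by ring
    have h5 : ∑ x ∈ Finset.range T with q < x, w (x + 1) t * (((x : ℝ) + 1) * w (x + 1) t) =
        E := Finset.sum_congr rfl fun _ _ => by ring
    rw [h5] at h3
    exact h3.trans (mul_le_mul_of_nonneg_left h4 hP0)
  have h3 : 26 / 25 * t + 1 ≤ E := by linarith
  have h4 := pow_le_pow_left₀ (by linarith) h3 2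
  by_contra hlt
  rw [not_le] at hlt
  nlinarith [mul_lt_mul_of_pos_right hlt (show 0 < (1 + 2 * t) ^ 2 by positivity)]

end IsPathWalk

/-! ### Trace distance and unitary evolution -/

theorem star_dotProduct_self {ι : Type*} [Fintype ι] (v : ι → ℂ) :
    star v ⬝ᵥ v = ((∑ k, ‖v k‖ ^ 2 : ℝ) : ℂ) := by
  rw [dotProduct]
  push_cast
  refine Finset.sum_congr rfl fun k _ => ?_
  rw [Pi.star_apply, RCLike.star_def, Complex.conj_mul']

/-- A matrix that preserves the inner product preserves the sum of the squared moduli. -/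
theorem sum_norm_sq_mulVec {ι : Type*} [Fintype ι] [DecidableEq ι] {U : Matrix ι ι ℂ}
    (hU : Uᴴ * U = 1) (v : ι → ℂ) : ∑ k, ‖(U *ᵥ v) k‖ ^ 2 = ∑ k, ‖v k‖ ^ 2 := by
  have h : star (U *ᵥ v) ⬝ᵥ (U *ᵥ v) = star v ⬝ᵥ v := by
    rw [Matrix.star_mulVec, Matrix.dotProduct_mulVec, Matrix.vecMul_vecMul, hU,
      Matrix.vecMul_one]
  rw [star_dotProduct_self, star_dotProduct_self] at h
  exact_mod_cast h

/-- A projective measurement in the computational basis distinguishes two states at most as well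
as their trace distance allows. The reason is that `2 P - 1`, for the projection `P` onto the
outcomes in `S`, is a contraction, so that its product with `ρ - τ` has a trace of modulus at most
the trace norm. -/
theorem norm_sum_diag_le_traceDistance {N : ℕ} (ρ τ : Matrix (Fin N) (Fin N) ℂ)
    (htr : (ρ - τ).trace = 0) (S : Finset (Fin N)) :
    ‖∑ k ∈ S, (ρ - τ) k k‖ ≤ traceDistance ρ τ := by
  set M := ρ - τ with hM
  have hK := Matrix.isHermitian_conjTranspose_mul_self M
  set v : Fin N → Fin N → ℂ := fun i => ⇑(hK.eigenvectorBasis i) with hv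
  have hunit : ∀ i, ∑ k, ‖v i k‖ ^ 2 = 1 := fun i => by
    have := hK.eigenvectorBasis.orthonormal.1 i
    rw [EuclideanSpace.norm_eq, Real.sqrt_eq_one] at this
    exact this
  have hlam : ∀ i, ∑ k, ‖(M *ᵥ v i) k‖ ^ 2 = hK.eigenvalues i := fun i => by
    have h1 : star (v i) ⬝ᵥ ((Mᴴ * M) *ᵥ v i) = star (M *ᵥ v i) ⬝ᵥ (M *ᵥ v i) := by
      rw [Matrix.star_mulVec, Matrix.dotProduct_mulVec, Matrix.dotProduct_mulVec,
        Matrix.vecMul_vecMul]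
    rw [hK.eigenvalues_eq i]
    change _ = RCLike.re (star (v i) ⬝ᵥ ((Mᴴ * M) *ᵥ v i))
    rw [h1, star_dotProduct_self]
    exact (Complex.ofReal_re _).symm
  set Q : Matrix (Fin N) (Fin N) ℂ := Matrix.diagonal fun k => if k ∈ S then 1 else -1 with hQ
  have htrQ : (Q * M).trace = 2 * ∑ k ∈ S, M k k := by
    have h1 : (Q * M).trace = ∑ k, (2 * (if k ∈ S then M k k else 0) - M k k) := by
      rw [Matrix.trace]
      refine Finset.sum_congr rfl fun k _ => ?_
      rw [Matrix.diag_apply, hQ, Matrix.diagonal_mul]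
      split_ifs <;> ring
    have h2 : ∑ k, M k k = 0 := htr
    rw [h1, Finset.sum_sub_distrib, ← Finset.mul_sum, h2, sub_zero, Finset.sum_ite_mem,
      Finset.univ_inter]
  have hbasis : (Q * M).trace = ∑ i, star (v i) ⬝ᵥ ((Q * M) *ᵥ v i) := by
    set U : Matrix (Fin N) (Fin N) ℂ := 
      (hK.eigenvectorUnitary : Matrix (Fin N) (Fin N) ℂ) with hU
    have hUU : U * star U = 1 := Unitary.mul_star_self_of_mem hK.eigenvectorUnitary.2
    have h1 : (Q * M).trace = (star U * ((Q * M) * U)).trace := by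
      rw [Matrix.trace_mul_comm (star U), Matrix.mul_assoc, hUU, Matrix.mul_one]
    rw [h1, Matrix.trace]
    refine Finset.sum_congr rfl fun i _ => ?_
    rw [Matrix.diag_apply, Matrix.mul_apply']
    rfl
  have hterm : ∀ i, ‖star (v i) ⬝ᵥ ((Q * M) *ᵥ v i)‖ ≤ √(hK.eigenvalues i) := fun i => by
    rw [dotProduct]
    refine (norm_sum_le _ _).trans ?_
    have h1 : ∀ k, ‖star (v i) k * ((Q * M) *ᵥ v i) k‖ = ‖v i k‖ * ‖(M *ᵥ v i) k‖ := fun k => by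
      rw [norm_mul, Pi.star_apply, norm_star, ← Matrix.mulVec_mulVec, hQ,
        Matrix.mulVec_diagonal, norm_mul]
      split_ifs <;> simp
    rw [Finset.sum_congr rfl fun k _ => h1 k]
    refine (Real.sum_mul_le_sqrt_mul_sqrt _ _ _).trans ?_
    rw [hunit, hlam, Real.sqrt_one, one_mul]
  have h2 : ‖(Q * M).trace‖ ≤ ∑ i, √(hK.eigenvalues i) := by
    rw [hbasis]
    exact (norm_sum_le _ _).trans (Finset.sum_le_sum fun i _ => hterm i)
  rw [htrQ, norm_mul, Complex.norm_ofNat] at h2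
  rw [traceDistance]
  linarith

/-- The evolution under a Hermitian matrix preserves the norm. -/
theorem sum_norm_sq_evolve {N : ℕ} {H : Matrix (Fin N) (Fin N) ℂ} (hH : H.IsHermitian) (t : ℝ)
    (ψ : Fin N → ℂ) : ∑ k, ‖evolve H t ψ k‖ ^ 2 = ∑ k, ‖ψ k‖ ^ 2 := by
  refine sum_norm_sq_mulVec ?_ ψ
  rw [← Matrix.exp_conjTranspose, Matrix.conjTranspose_smul, hH.eq,
    ← Matrix.exp_add_of_commute _ _ ((Commute.refl H).smul_left _ |>.smul_right _), ← add_smul]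
  simp

theorem evolve_zero {N : ℕ} (H : Matrix (Fin N) (Fin N) ℂ) (ψ : Fin N → ℂ) :
    evolve H 0 ψ = ψ := by
  simp [evolve]

open scoped Matrix.Norms.Operator in
/-- The Schrödinger equation. -/
theorem hasDerivAt_evolve {N : ℕ} (H : Matrix (Fin N) (Fin N) ℂ) (ψ : Fin N → ℂ) (t : ℝ)
    (k : Fin N) : HasDerivAt (fun t => evolve H t ψ k)
      (-Complex.I * ∑ l, H k l * evolve H t ψ l) t := by
  have h1 : HasDerivAt (fun t : ℝ => NormedSpace.exp (t • ((-Complex.I) • H)))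
      (((-Complex.I) • H) * NormedSpace.exp (t • ((-Complex.I) • H))) t :=
    hasDerivAt_exp_smul_const' _ t
  have h2 : ∀ t : ℝ, t • ((-Complex.I) • H) = (-(Complex.I * (t : ℂ))) • H := fun t => by
    rw [← Complex.coe_smul, smul_smul]; ring_nf
  simp only [h2] at h1
  have h3 : HasDerivAt (fun t : ℝ => evolve H t ψ k)
      (((((-Complex.I) • H) * NormedSpace.exp ((-(Complex.I * (t : ℂ))) • H)) *ᵥ ψ) k) t := by
    have h4 : ∀ l, HasDerivAt
        (fun t : ℝ => NormedSpace.exp ((-(Complex.I * (t : ℂ))) • H) k l)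
        ((((-Complex.I) • H) * NormedSpace.exp ((-(Complex.I * (t : ℂ))) • H)) k l) t := fun l =>
      ((Matrix.entryLinearMap ℝ ℂ k l).toContinuousLinearMap.hasFDerivAt.comp_hasDerivAt t h1)
    change HasDerivAt
      (fun t : ℝ => ∑ l, NormedSpace.exp ((-(Complex.I * (t : ℂ))) • H) k l * ψ l)
      (∑ l, (((-Complex.I) • H) * NormedSpace.exp ((-(Complex.I * (t : ℂ))) • H)) k l * ψ l) t
    exact HasDerivAt.fun_sum fun l _ => (h4 l).mul_const (ψ l)
  convert h3 using 1
  rw [← Matrix.mulVec_mulVec, Matrix.smul_mulVec]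
  rfl

/-! ### The walk on the permutation-chain graph -/

section Chain

variable {n T : ℕ}

/-- The vertex `u` is joined to the vertex `v` of the next column. -/
def ChainStep (σ : PermChain n T) (u v : Fin T × Fin (2 ^ n)) : Prop :=
  ∃ i : Fin (T - 1), (u.1 : ℕ) = i ∧ (v.1 : ℕ) = i + 1 ∧ v.2 = σ i u.2

theorem chainGraph_adj (σ : PermChain n T) (u v : Fin T × Fin (2 ^ n)) :
    (chainGraph σ).Adj u v ↔ ChainStep σ u v ∨ ChainStep σ v u := by
  rw [chainGraph, SimpleGraph.fromRel_adj]
  refine ⟨fun h => h.2, fun h => ⟨?_, h⟩⟩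
  rintro rfl
  rcases h with ⟨i, h1, h2, _⟩ | ⟨i, h1, h2, _⟩ <;> omega

theorem ChainStep.right_unique {σ : PermChain n T} {u v v' : Fin T × Fin (2 ^ n)}
    (h : ChainStep σ u v) (h' : ChainStep σ u v') : v = v' := by
  obtain ⟨i, h1, h2, h3⟩ := h
  obtain ⟨i', h1', h2', h3'⟩ := h'
  obtain rfl : i = i' := Fin.ext (by omega)
  exact Prod.ext (Fin.ext (by omega)) (by rw [h3, h3'])

theorem ChainStep.left_unique {σ : PermChain n T} {u u' v : Fin T × Fin (2 ^ n)}
    (h : ChainStep σ u v) (h' : ChainStep σ u' v) : u = u' := by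
  obtain ⟨i, h1, h2, h3⟩ := h
  obtain ⟨i', h1', h2', h3'⟩ := h'
  obtain rfl : i = i' := Fin.ext (by omega)
  exact Prod.ext (Fin.ext (by omega)) ((σ i).injective (by rw [← h3, ← h3']))

open Classical in
theorem chainHamiltonian_apply (σ : PermChain n T) (k l : Fin (T * 2 ^ n)) :
    chainHamiltonian σ k l =
      if ChainStep σ (finProdFinEquiv.symm k) (finProdFinEquiv.symm l) ∨
        ChainStep σ (finProdFinEquiv.symm l) (finProdFinEquiv.symm k) then 1 else 0 := by
  simp only [chainHamiltonian, Matrix.reindex_apply, Matrix.submatrix_apply,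
    SimpleGraph.adjMatrix_apply, chainGraph_adj]

theorem chainHamiltonian_isHermitian (σ : PermChain n T) : (chainHamiltonian σ).IsHermitian := by
  classical
  refine Matrix.IsHermitian.ext fun k l => ?_
  simp only [chainHamiltonian_apply, or_comm]
  split_ifs <;> simp

theorem chainHamiltonian_isSparse (σ : PermChain n T) : IsSparse 2 (chainHamiltonian σ) := by
  classical
  intro k
  have hsub : rowSupport (chainHamiltonian σ) k ⊆
      (Finset.univ.filter fun l =>
        ChainStep σ (finProdFinEquiv.symm k) (finProdFinEquiv.symm l)) ∪
      (Finset.univ.filter fun l =>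
        ChainStep σ (finProdFinEquiv.symm l) (finProdFinEquiv.symm k)) := by
    intro l hl
    rw [rowSupport, Finset.mem_filter, chainHamiltonian_apply] at hl
    have := hl.2
    simp only [Finset.mem_union, Finset.mem_filter, Finset.mem_univ, true_and]
    by_contra hn
    rw [if_neg hn] at this
    exact this rfl
  refine (Finset.card_le_card hsub).trans ((Finset.card_union_le _ _).trans
    (Nat.add_le_add (b := 1) (d := 1)
    (Finset.card_le_one.2 fun a ha b hb => finProdFinEquiv.symm.injective ?_)
    (Finset.card_le_one.2 fun a ha b hb => finProdFinEquiv.symm.injective ?_)))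
  · exact (Finset.mem_filter.1 ha).2.right_unique (Finset.mem_filter.1 hb).2
  · exact (Finset.mem_filter.1 ha).2.left_unique (Finset.mem_filter.1 hb).2

theorem norm_chainHamiltonian_le (σ : PermChain n T) (k l : Fin (T * 2 ^ n)) :
    ‖chainHamiltonian σ k l‖ ≤ 1 := by
  classical
  rw [chainHamiltonian_apply]
  split_ifs <;> simp

/-- The vertex with the number `j` on the path that starts in `(0, 0ⁿ)`, without its column; it
has the value `0` from the column `T` on. -/
def chainPath (σ : PermChain n T) : ℕ → Fin (2 ^ n)
  | 0 => 0
  | j + 1 => if h : j < T - 1 then σ ⟨j, h⟩ (chainPath σ j) else 0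

theorem chainPath_succ (σ : PermChain n T) {j : ℕ} (h : j < T - 1) :
    chainPath σ (j + 1) = σ ⟨j, h⟩ (chainPath σ j) := by
  rw [chainPath, dif_pos h]

open Classical in
/-- The basis states of the vertices of the path beyond the column `q`. -/
def pathBeyond (σ : PermChain n T) (q : ℕ) : Finset (Fin (T * 2 ^ n)) :=
  Finset.univ.filter fun k =>
    q < ((finProdFinEquiv.symm k).1 : ℕ) ∧
      (finProdFinEquiv.symm k).2 = chainPath σ (finProdFinEquiv.symm k).1

theorem sum_pathBeyond (σ : PermChain n T) (q : ℕ) (f : Fin (T * 2 ^ n) → ℝ) :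
    ∑ k ∈ pathBeyond σ q, f k =
      ∑ j : Fin T, if q < (j : ℕ) then f (finProdFinEquiv (j, chainPath σ j)) else 0 := by
  classical
  rw [pathBeyond, Finset.sum_filter, ← finProdFinEquiv.sum_comp, Fintype.sum_prod_type]
  refine Finset.sum_congr rfl fun j _ => ?_
  simp only [Equiv.symm_apply_apply]
  by_cases hq : q < (j : ℕ) <;> simp [hq]

/-- The amplitude of the evolved state on the path, at the site `x`, which is in the column
`x - 1`; it is `0` outside the graph. -/
def pathAmplitude (σ : PermChain n T) (x : ℕ) (t : ℝ) : ℂ :=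
  match x with
  | 0 => 0
  | j + 1 => if h : j < T then
      evolve (chainHamiltonian σ) t (zeroState _) (finProdFinEquiv (⟨j, h⟩, chainPath σ j)) else 0

theorem pathAmplitude_succ (σ : PermChain n T) {j : ℕ} (h : j < T) (t : ℝ) :
    pathAmplitude σ (j + 1) t =
      evolve (chainHamiltonian σ) t (zeroState _)
        (finProdFinEquiv (⟨j, h⟩, chainPath σ j)) := by
  rw [pathAmplitude, dif_pos h]

/-- On the path, the Hamiltonian is the adjacency matrix of the path. -/
theorem sum_chainHamiltonian_path (σ : PermChain n T) {j : ℕ} (h : j < T) (t : ℝ) :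
    ∑ l, chainHamiltonian σ (finProdFinEquiv (⟨j, h⟩, chainPath σ j)) l *
      evolve (chainHamiltonian σ) t (zeroState _) l =
      pathAmplitude σ j t + pathAmplitude σ (j + 2) t := by
  classical
  set φ := evolve (chainHamiltonian σ) t (zeroState _) with hφ
  set u : Fin T × Fin (2 ^ n) := (⟨j, h⟩, chainPath σ j) with hu
  have h1 : ∀ v, chainHamiltonian σ (finProdFinEquiv u) (finProdFinEquiv v) *
      φ (finProdFinEquiv v) = (if ChainStep σ v u then φ (finProdFinEquiv v) else 0) +
        if ChainStep σ u v then φ (finProdFinEquiv v) else 0 := fun v => by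
    have hne : ¬ (ChainStep σ v u ∧ ChainStep σ u v) := by
      rintro ⟨⟨i, _, _, _⟩, ⟨i', _, _, _⟩⟩
      omega
    simp only [chainHamiltonian_apply, Equiv.symm_apply_apply]
    by_cases ha : ChainStep σ v u <;> by_cases hb : ChainStep σ u v <;> simp [ha, hb]
    exact absurd ⟨ha, hb⟩ hne
  rw [← finProdFinEquiv.sum_comp, Finset.sum_congr rfl fun v _ => h1 v, Finset.sum_add_distrib]
  congr 1
  · rcases j with _ | j
    · refine Finset.sum_eq_zero fun v _ => if_neg ?_
      rintro ⟨i, _, h2, _⟩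
      simp [hu] at h2
    · have hs : ChainStep σ (⟨j, by omega⟩, chainPath σ j) u :=
        ⟨⟨j, by omega⟩, rfl, rfl, chainPath_succ σ (by omega)⟩
      have h2 : ∀ v, ChainStep σ v u ↔ v = (⟨j, by omega⟩, chainPath σ j) := fun v =>
        ⟨fun hv => hv.left_unique hs, fun hv => hv ▸ hs⟩
      simp only [h2, Finset.sum_ite_eq', Finset.mem_univ, if_true]
      rw [pathAmplitude_succ]
  · by_cases hj : j + 1 < T
    · have hs : ChainStep σ u (⟨j + 1, hj⟩, chainPath σ (j + 1)) :=
        ⟨⟨j, by omega⟩, rfl, rfl, chainPath_succ σ (by omega)⟩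
      have h2 : ∀ v, ChainStep σ u v ↔ v = (⟨j + 1, hj⟩, chainPath σ (j + 1)) := fun v =>
        ⟨fun hv => hv.right_unique hs, fun hv => hv ▸ hs⟩
      simp only [h2, Finset.sum_ite_eq', Finset.mem_univ, if_true]
      rw [pathAmplitude_succ]
    · rw [pathAmplitude, dif_neg hj]
      refine Finset.sum_eq_zero fun v _ => if_neg ?_
      rintro ⟨i, h2, _, _⟩
      have := i.2
      simp only [hu] at h2
      omega

/-- Without its phase `(-i)ˣ⁻¹`, the amplitude on the path is a walk in the sense of
`IsPathWalk`. -/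
theorem isPathWalk_pathAmplitude (hT : 0 < T) (σ : PermChain n T) :
    IsPathWalk T fun x t => (Complex.I ^ (x + 3) * pathAmplitude σ x t).re where
  left s := by simp [pathAmplitude]
  right s := by simp [pathAmplitude]
  deriv x hx s := by
    have h1 := hasDerivAt_evolve (chainHamiltonian σ) (zeroState _) s
      (finProdFinEquiv (⟨x, hx⟩, chainPath σ x))
    rw [sum_chainHamiltonian_path] at h1
    have h2 := Complex.reCLM.hasFDerivAt.comp_hasDerivAt s (h1.const_mul (Complex.I ^ (x + 4)))
    have h3 : ∀ s, pathAmplitude σ (x + 1) s = _ := fun s => pathAmplitude_succ σ hx s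
    simp only [h3]
    refine h2.congr_deriv ?_
    rw [Complex.reCLM_apply, ← Complex.sub_re]
    congr 1
    have h4 : Complex.I ^ 2 = -1 := Complex.I_sq
    linear_combination (-Complex.I ^ (x + 3) * pathAmplitude σ x s -
      Complex.I ^ (x + 3) * pathAmplitude σ (x + 2) s + Complex.I ^ (x + 3) *
      pathAmplitude σ (x + 2) s) * h4
  start := by
    rw [pathAmplitude_succ σ hT, evolve_zero, zeroState, if_pos]
    · simp
    · simp [chainPath]
  start' x hx hxT := by
    rw [pathAmplitude_succ σ hxT, evolve_zero, zeroState, if_neg]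
    · simp
    · have : 0 < 2 ^ n := by positivity
      simp only [finProdFinEquiv, Equiv.coe_fn_mk]
      positivity

/-- After the time `t`, the walk is beyond the column `t / 100` with a probability bounded away
from `1 / 4`. -/
theorem prob_pathBeyond_ge (σ : PermChain n T) {t : ℝ} (ht : 100000 ≤ t) (hT : 2 * t ≤ T)
    {q : ℕ} (hq : (q : ℝ) < 1 / 100 * t) :
    27 / 100 ≤ ∑ k ∈ pathBeyond σ q, ‖evolve (chainHamiltonian σ) t (zeroState _) k‖ ^ 2 := by
  have hT0 : 0 < T := by
    have : (0 : ℝ) < T := by linarith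
    exact_mod_cast this
  refine ((isPathWalk_pathAmplitude hT0 σ).tail_prob_ge ht hT hq).trans ?_
  rw [sum_pathBeyond, Finset.sum_filter, Finset.sum_range]
  refine Finset.sum_le_sum fun j _ => ?_
  split_ifs with hj
  · rw [pathAmplitude_succ σ j.2]
    refine (sq_le_sq.2 ((Complex.abs_re_le_norm _).trans (le_abs_self _))).trans ?_
    simp
  · exact le_rfl

end Chain

/-! ### Replacing the oracle in each round -/

section Replace

variable {ι : Type*}

open Classical in
/-- The part of `v` on the basis states in the set `E`. -/
def ampOn (E : ι → Prop) (v : ι → ℂ) : ι → ℂ := fun m => if E m then v m else 0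

theorem ampOn_add (E : ι → Prop) (v w : ι → ℂ) : ampOn E (v + w) = ampOn E v + ampOn E w := by
  funext m
  simp only [ampOn, Pi.add_apply]
  split_ifs <;> simp

variable [Fintype ι]

/-- The Euclidean norm of a vector of amplitudes. -/
def ampNorm (v : ι → ℂ) : ℝ := √(∑ m, ‖v m‖ ^ 2)

theorem ampNorm_sq (v : ι → ℂ) : ampNorm v ^ 2 = ∑ m, ‖v m‖ ^ 2 :=
  Real.sq_sqrt (Finset.sum_nonneg fun _ _ => sq_nonneg _)

theorem ampNorm_add_le (v w : ι → ℂ) : ampNorm (v + w) ≤ ampNorm v + ampNorm w := by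
  have := norm_add_le (WithLp.toLp 2 v : EuclideanSpace ℂ ι) (WithLp.toLp 2 w)
  rwa [EuclideanSpace.norm_eq, EuclideanSpace.norm_eq, EuclideanSpace.norm_eq] at this

theorem ampNorm_comp_perm (v : ι → ℂ) (e : Equiv.Perm ι) :
    ampNorm (fun m => v (e m)) = ampNorm v := by
  rw [ampNorm, ampNorm, Equiv.sum_comp e fun m => ‖v m‖ ^ 2]

theorem ampNorm_mulVec [DecidableEq ι] (U : Matrix.unitaryGroup ι ℂ) (v : ι → ℂ) :
    ampNorm ((U : Matrix ι ι ℂ) *ᵥ v) = ampNorm v := by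
  rw [ampNorm, ampNorm, sum_norm_sq_mulVec (Matrix.mem_unitaryGroup_iff'.1 U.2)]

theorem ampNorm_ampOn_sq (E : ι → Prop) [DecidablePred E] (v : ι → ℂ) :
    ampNorm (ampOn E v) ^ 2 = ∑ m, if E m then ‖v m‖ ^ 2 else 0 := by
  rw [ampNorm_sq]
  refine Finset.sum_congr rfl fun m _ => ?_
  rw [ampOn]
  by_cases h : E m <;> simp [h]

theorem ampNorm_ampOn_le (E : ι → Prop) (v : ι → ℂ) : ampNorm (ampOn E v) ≤ ampNorm v := by
  refine Real.sqrt_le_sqrt (Finset.sum_le_sum fun m _ => ?_)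
  rw [ampOn]
  split_ifs <;> simp

/-- Two permutations of the basis act differently on a state only through the part of the state on
the basis states that they map differently. -/
theorem ampNorm_perm_sub_le (v : ι → ℂ) (P Q : Equiv.Perm ι) :
    ampNorm ((fun m => v (P.symm m)) - fun m => v (Q.symm m)) ≤
      2 * ampNorm (ampOn (fun m => P m ≠ Q m) v) := by
  set b := ampOn (fun m => P m ≠ Q m) v with hb
  have h : ((fun m => v (P.symm m)) - fun m => v (Q.symm m)) =
      (fun m => b (P.symm m)) + fun m => -b (Q.symm m) := by
    funext m
    simp only [Pi.sub_apply, Pi.add_apply, hb, ampOn]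
    by_cases hP : P (P.symm m) ≠ Q (P.symm m)
    · have hQ : P (Q.symm m) ≠ Q (Q.symm m) := by
        intro hQ
        rw [Equiv.apply_symm_apply] at hQ
        have : P.symm m = Q.symm m := by rw [Equiv.symm_apply_eq, hQ]
        rw [this] at hP
        exact hP (by rw [hQ, Equiv.apply_symm_apply])
      rw [if_pos hP, if_pos hQ, sub_eq_add_neg]
    · rw [not_not, Equiv.apply_symm_apply] at hP
      have h1 : Q.symm m = P.symm m := by rw [Equiv.symm_apply_eq]; exact hP
      rw [h1, if_neg (by simpa using hP)]
      simp
  have hneg : ampNorm (fun m => -b (Q.symm m)) = ampNorm (fun m => b (Q.symm m)) := by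
    simp [ampNorm]
  rw [h]
  refine (ampNorm_add_le _ _).trans ?_
  have h1 := ampNorm_comp_perm b P.symm
  have h2 := ampNorm_comp_perm b Q.symm
  rw [hneg, h1, h2]
  linarith

end Replace

/-- The row of the matrix that a query slot asks for. -/
def slotRow {N b : ℕ} : QuerySlot N b → Option (Fin N) :=
  Sum.elim (fun _ => none) (Sum.elim (fun s => some s.1)
    (Sum.elim (fun s => some s.1) fun s => some s.1))

/-- The answer to a query depends only on the row it asks for. -/
theorem slotOracle_congr {N b : ℕ} (enc : ℂ → Fin b → ZMod 2) {H H' : Matrix (Fin N) (Fin N) ℂ}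
    (s : QuerySlot N b) (h : ∀ u, slotRow s = some u → H u = H' u) :
    slotOracle enc H s = slotOracle enc H' s := by
  have hsupp : ∀ u, H u = H' u → rowSupport H u = rowSupport H' u := fun u hu => by
    simp only [rowSupport, hu]
  rcases s with s | s | s | s
  · change (Sum.inl s : QuerySlot N b) = Sum.inl s
    rfl
  · have := h s.1 rfl
    change (Sum.inr (Sum.inl (s.1, s.2.1, s.2.2 + enc (H s.1 s.2.1))) : QuerySlot N b) =
      Sum.inr (Sum.inl (s.1, s.2.1, s.2.2 + enc (H' s.1 s.2.1)))
    rw [this]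
  · have := hsupp _ (h s.1 rfl)
    change (Sum.inr (Sum.inr (Sum.inl (s.1, listFirst (rowSupport H s.1) s.2))) :
      QuerySlot N b) = Sum.inr (Sum.inr (Sum.inl (s.1, listFirst (rowSupport H' s.1) s.2)))
    rw [this]
  · have := hsupp _ (h s.1 rfl)
    change Sum.inr (Sum.inr (Sum.inr (s.1, (listFirst (rowSupport H s.1)).symm s.2))) =
      Sum.inr (Sum.inr (Sum.inr (s.1, (listFirst (rowSupport H' s.1)).symm s.2)))
    rw [this]

theorem parallelOracle_apply {N p b w : ℕ} (enc : ℂ → Fin b → ZMod 2)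
    (H : Matrix (Fin N) (Fin N) ℂ) (m : MemoryBasis N p b w) :
    parallelOracle p w enc H m = (m.1, (fun i => slotOracle enc H (m.2.1 i)), m.2.2) :=
  rfl

theorem exists_slotRow_of_parallelOracle_ne {N p b w : ℕ} (enc : ℂ → Fin b → ZMod 2)
    {H H' : Matrix (Fin N) (Fin N) ℂ} {m : MemoryBasis N p b w}
    (h : parallelOracle p w enc H m ≠ parallelOracle p w enc H' m) :
    ∃ i, ∃ u, slotRow (m.2.1 i) = some u ∧ H u ≠ H' u := by
  by_contra! hn
  refine h ?_
  rw [parallelOracle_apply, parallelOracle_apply]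
  have : (fun i => slotOracle enc H (m.2.1 i)) = fun i => slotOracle enc H' (m.2.1 i) :=
    funext fun i => slotOracle_congr enc _ (hn i)
  rw [this]

namespace QueryAlgorithm

variable {N p b : ℕ} (A : QueryAlgorithm N p b) (enc : ℂ → Fin b → ZMod 2)

/-- The state of the memory after `r` rounds if the round with number `s` (counted from `0`) uses
the oracles of the matrix `H s`. -/
def hybridState (H : ℕ → Matrix (Fin N) (Fin N) ℂ) (ψ : Fin N → ℂ) :
    ℕ → (MemoryBasis N p b A.work → ℂ)
  | 0 => (A.gate 0 : Matrix _ _ ℂ) *ᵥ A.initialState ψ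
  | r + 1 => (A.gate (r + 1) : Matrix _ _ ℂ) *ᵥ
      fun m => hybridState H ψ r ((parallelOracle p A.work enc (H r)).symm m)

theorem hybridState_const (H : Matrix (Fin N) (Fin N) ℂ) (ψ : Fin N → ℂ) (r : ℕ) :
    A.hybridState enc (fun _ => H) ψ r = A.stateAfter enc H ψ r := by
  induction r with
  | zero => rfl
  | succ r ih => rw [hybridState, stateAfter, ih]

theorem hybridState_congr {H H' : ℕ → Matrix (Fin N) (Fin N) ℂ} (ψ : Fin N → ℂ) (r : ℕ)
    (h : ∀ s < r, H s = H' s) : A.hybridState enc H ψ r = A.hybridState enc H' ψ r := by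
  induction r with
  | zero => rfl
  | succ r ih =>
    rw [hybridState, hybridState, ih fun s hs => h s (by omega), h r (by omega)]

theorem ampNorm_hybridState (H : ℕ → Matrix (Fin N) (Fin N) ℂ) (ψ : Fin N → ℂ) (r : ℕ) :
    ampNorm (A.hybridState enc H ψ r) = ampNorm ψ := by
  induction r with
  | zero =>
    rw [hybridState, ampNorm_mulVec, ampNorm, ampNorm, Fintype.sum_prod_type]
    congr 1
    refine Finset.sum_congr rfl fun k _ => ?_
    rw [Finset.sum_eq_single_of_mem (fun _ => Sum.inl (), 0) (Finset.mem_univ _)]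
    · simp [initialState]
    · intro x _ hx
      simp [initialState, hx]
  | succ r ih => rw [hybridState, ampNorm_mulVec, ampNorm_comp_perm, ih]

/-- Each round adds to the distance of the two runs at most twice the weight of the hybrid state on
the basis states on which the oracles of this round differ. -/
theorem ampNorm_stateAfter_sub_le (H : Matrix (Fin N) (Fin N) ℂ)
    (H' : ℕ → Matrix (Fin N) (Fin N) ℂ) (ψ : Fin N → ℂ) (r : ℕ) :
    ampNorm (A.stateAfter enc H ψ r - A.hybridState enc H' ψ r) ≤
      ∑ s ∈ Finset.range r, 2 * ampNorm (ampOn (fun m => parallelOracle p A.work enc H m ≠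
        parallelOracle p A.work enc (H' s) m) (A.hybridState enc H' ψ s)) := by
  induction r with
  | zero => simp [stateAfter, hybridState, ampNorm]
  | succ r ih =>
    rw [Finset.sum_range_succ, stateAfter, hybridState, ← Matrix.mulVec_sub, ampNorm_mulVec]
    set P := parallelOracle p A.work enc H
    set Q := parallelOracle p A.work enc (H' r)
    set φ := A.stateAfter enc H ψ r
    set χ := A.hybridState enc H' ψ r
    have h1 : ((fun m => φ (P.symm m)) - fun m => χ (Q.symm m)) =
        (fun m => (φ - χ) (P.symm m)) + ((fun m => χ (P.symm m)) - fun m => χ (Q.symm m)) := by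
      funext m
      simp
    rw [h1]
    refine (ampNorm_add_le _ _).trans ?_
    rw [ampNorm_comp_perm]
    exact add_le_add ih (ampNorm_perm_sub_le χ P Q)

/-- The hybrid bound: the probability that the measurement of the true final state lands in `E` is
controlled by the one for the hybrid state, and by the weights of the queries to
the places where the oracles were changed. -/
theorem ampNorm_ampOn_stateAfter_sq_le (H : Matrix (Fin N) (Fin N) ℂ)
    (H' : ℕ → Matrix (Fin N) (Fin N) ℂ) (ψ : Fin N → ℂ) (r : ℕ)
    (E : MemoryBasis N p b A.work → Prop) :
    ampNorm (ampOn E (A.stateAfter enc H ψ r)) ^ 2 ≤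
      (r + 1) * (∑ s ∈ Finset.range r, 4 * ampNorm (ampOn (fun m =>
        parallelOracle p A.work enc H m ≠ parallelOracle p A.work enc (H' s) m)
          (A.hybridState enc H' ψ s)) ^ 2 + ampNorm (ampOn E (A.hybridState enc H' ψ r)) ^ 2) := by
  set φ := A.stateAfter enc H ψ r
  set χ := A.hybridState enc H' ψ r
  set β : ℕ → ℝ := fun s => ampNorm (ampOn (fun m => parallelOracle p A.work enc H m ≠
        parallelOracle p A.work enc (H' s) m) (A.hybridState enc H' ψ s)) with hβ
  -- the `r + 1` contributions to the norm, for the inequality of Cauchy and Schwarz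
  set f : ℕ → ℝ := fun s => if s < r then 2 * β s else ampNorm (ampOn E χ) with hf
  have h1 : ampNorm (ampOn E φ) ≤ ∑ s ∈ Finset.range (r + 1), f s := by
    have h2 : φ = (φ - χ) + χ := by simp
    have h3 : ∑ s ∈ Finset.range r, f s = ∑ s ∈ Finset.range r, 2 * β s :=
      Finset.sum_congr rfl fun s hs => if_pos (Finset.mem_range.1 hs)
    rw [Finset.sum_range_succ, h3]
    calc ampNorm (ampOn E φ) ≤ ampNorm (ampOn E (φ - χ)) + ampNorm (ampOn E χ) := by
          conv_lhs => rw [h2, ampOn_add]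
          exact ampNorm_add_le _ _
      _ ≤ _ := by
          refine add_le_add ((ampNorm_ampOn_le _ _).trans
            (A.ampNorm_stateAfter_sub_le enc H H' ψ r)) ?_
          simp [hf]
  have h4 := pow_le_pow_left₀ (Real.sqrt_nonneg _) h1 2
  refine h4.trans ((sq_sum_le_card_mul_sum_sq).trans ?_)
  rw [Finset.card_range, Finset.sum_range_succ]
  push_cast
  have h5 : ∑ s ∈ Finset.range r, f s ^ 2 = ∑ s ∈ Finset.range r, 4 * β s ^ 2 :=
    Finset.sum_congr rfl fun s hs => by
      simp only [hf, if_pos (Finset.mem_range.1 hs)]; ring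
  have h6 : f r = ampNorm (ampOn E χ) := if_neg (lt_irrefl r)
  rw [h5, h6]

end QueryAlgorithm

/-! ### Random chains with hidden paths -/

section Hidden

variable {n T : ℕ}

/-- The path through the vertices `x`, where `x i` is the vertex in the column `i + 1`. -/
def targetPath (x : Fin (T - 1) → Fin (2 ^ n)) : ℕ → Fin (2 ^ n)
  | 0 => 0
  | j + 1 => if h : j < T - 1 then x ⟨j, h⟩ else 0

/-- The chain that results from `B` if the path from `(0, 0ⁿ)` is redirected to the vertices
`x`. -/
def redirect (B : PermChain n T) (x : Fin (T - 1) → Fin (2 ^ n)) : PermChain n T :=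
  fun i => Equiv.swap (B i (targetPath x i)) (x i) * B i

theorem chainPath_redirect (B : PermChain n T) (x : Fin (T - 1) → Fin (2 ^ n)) (j : ℕ) :
    chainPath (redirect B x) j = targetPath x j := by
  induction j with
  | zero => rfl
  | succ j ih =>
    rw [chainPath, targetPath]
    split_ifs with h
    · simp [redirect, ih]
    · rfl

/-- If `B` and `x` are uniformly random, then so is the redirected chain: it determines `x`, and
`B` can be recovered from it and from the values of `B` on the path. -/
theorem sum_redirect (f : PermChain n T → ℝ) :
    ∑ B : PermChain n T, ∑ x : Fin (T - 1) → Fin (2 ^ n), f (redirect B x) =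
      Fintype.card (Fin (T - 1) → Fin (2 ^ n)) * ∑ σ, f σ := by
  -- the second component of `Φ` makes up for the information on `B` that the redirection loses
  set Φ : PermChain n T × (Fin (T - 1) → Fin (2 ^ n)) →
      PermChain n T × (Fin (T - 1) → Fin (2 ^ n)) :=
    fun p => (redirect p.1 p.2, fun i => p.1 i (targetPath p.2 i)) with hΦ
  have hinj : Function.Injective Φ := by
    rintro ⟨B, x⟩ ⟨B', x'⟩ h
    have h1 : redirect B x = redirect B' x' := congrArg Prod.fst h
    have h2 : ∀ i, B i (targetPath x i) = B' i (targetPath x' i) :=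
      fun i => congrFun (congrArg Prod.snd h) i
    have hx : x = x' := by
      funext i
      have h3 := chainPath_redirect B x (i + 1)
      rw [h1, chainPath_redirect] at h3
      simpa [targetPath] using h3.symm
    subst hx
    refine Prod.ext (funext fun i => ?_) rfl
    have h3 := congrFun h1 i
    rw [redirect, redirect, h2 i] at h3
    exact mul_left_cancel h3
  have hbij : Function.Bijective Φ := Finite.injective_iff_bijective.1 hinj
  rw [← Fintype.sum_prod_type', Function.Bijective.sum_comp hbij fun p => f p.1,
    Fintype.sum_prod_type, Finset.mul_sum]
  refine Finset.sum_congr rfl fun σ _ => ?_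
  simp [Finset.sum_const]

/-- The redirected chain, where only the first `r` permutations are redirected. -/
def redirectUpTo (r : ℕ) (B : PermChain n T) (x : Fin (T - 1) → Fin (2 ^ n)) : PermChain n T :=
  fun i => if (i : ℕ) < r then redirect B x i else B i

theorem redirectUpTo_congr {r : ℕ} (B : PermChain n T) {x x' : Fin (T - 1) → Fin (2 ^ n)}
    (h : ∀ m : Fin (T - 1), (m : ℕ) < r → x m = x' m) :
    redirectUpTo r B x = redirectUpTo r B x' := by
  funext i
  rw [redirectUpTo, redirectUpTo]
  split_ifs with hi
  · have : targetPath x i = targetPath x' i := by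
      rcases i with ⟨_ | j, hj⟩
      · rfl
      · simp only [targetPath]
        split_ifs with h'
        · exact h _ (by simp only at hi ⊢; omega)
        · rfl
    rw [redirect, redirect, this, h i hi]
  · rfl

/-- If `F` does not depend on the coordinates from `r` on, then the event that one of these
coordinates has a prescribed value has probability `2 ^ (-n)`, independently of `F`. -/
theorem sum_coincidence_le {r a j : ℕ} (c : Fin (T - 1) → Fin (2 ^ n))
    (F : (Fin (T - 1) → Fin (2 ^ n)) → ℝ) (hF0 : ∀ x, 0 ≤ F x)
    (hF : ∀ x x', (∀ m : Fin (T - 1), (m : ℕ) < r → x m = x' m) → F x = F x')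
    (E : (Fin (T - 1) → Fin (2 ^ n)) → Prop) [DecidablePred E]
    (hE : ∀ x, E x → ∃ m : Fin (T - 1), r ≤ m ∧ (m : ℕ) + a = j ∧ x m = c m) :
    2 ^ n * ∑ x, (if E x then F x else 0) ≤ ∑ x, F x := by
  by_cases hm : ∃ m : Fin (T - 1), r ≤ m ∧ (m : ℕ) + a = j
  · obtain ⟨m, hrm, hmj⟩ := hm
    have h1 : ∀ v, ∑ x, (if x m = v then F x else 0) = ∑ x, if x m = c m then F x else 0 := by
      intro v
      -- the bijection that exchanges `v` and `c m` in the coordinate `m`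
      set e : Equiv.Perm (Fin (T - 1) → Fin (2 ^ n)) := Equiv.piCongrRight fun m' =>
        if m' = m then Equiv.swap v (c m) else Equiv.refl _ with he
      rw [← Equiv.sum_comp e]
      refine Finset.sum_congr rfl fun x _ => ?_
      have h2 : F (e x) = F x := hF _ _ fun m' hm' => by
        have : m' ≠ m := by rintro rfl; omega
        simp [he, this]
      have h3 : e x m = Equiv.swap v (c m) (x m) := by simp [he]
      rw [h2, h3]
      have h4 : Equiv.swap v (c m) (x m) = v ↔ x m = c m := by
        rw [Equiv.swap_apply_eq_iff, Equiv.swap_apply_left]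
      simp only [h4]
    have h2 : ∑ x, F x = ∑ v : Fin (2 ^ n), ∑ x, if x m = v then F x else 0 := by
      rw [Finset.sum_comm]
      simp
    rw [h2, Finset.sum_congr rfl fun v _ => h1 v, Finset.sum_const, Finset.card_univ,
      Fintype.card_fin, nsmul_eq_mul]
    push_cast
    gcongr with x
    by_cases hEx : E x
    · obtain ⟨m', _, hm', hc⟩ := hE x hEx
      obtain rfl : m' = m := Fin.ext (by omega)
      rw [if_pos hEx, if_pos hc]
    · rw [if_neg hEx]
      split_ifs
      exacts [hF0 x, le_rfl]
  · have : ∀ x, ¬ E x := fun x hx => by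
      obtain ⟨m, h1, h2, _⟩ := hE x hx
      exact hm ⟨m, h1, h2⟩
    simp only [this, if_false, Finset.sum_const_zero, mul_zero]
    exact Finset.sum_nonneg fun x _ => hF0 x

theorem chainHamiltonian_row_congr {σ τ : PermChain n T} (k : Fin (T * 2 ^ n))
    (h1 : ∀ i : Fin (T - 1), ((finProdFinEquiv.symm k).1 : ℕ) = i →
      σ i (finProdFinEquiv.symm k).2 = τ i (finProdFinEquiv.symm k).2)
    (h2 : ∀ i : Fin (T - 1), ((finProdFinEquiv.symm k).1 : ℕ) = i + 1 →
      (σ i).symm (finProdFinEquiv.symm k).2 = (τ i).symm (finProdFinEquiv.symm k).2) :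
    chainHamiltonian σ k = chainHamiltonian τ k := by
  classical
  funext l
  have e1 : ChainStep σ (finProdFinEquiv.symm k) (finProdFinEquiv.symm l) ↔
      ChainStep τ (finProdFinEquiv.symm k) (finProdFinEquiv.symm l) := by
    refine exists_congr fun i => and_congr_right fun hi => ?_
    rw [h1 i hi]
  have e2 : ChainStep σ (finProdFinEquiv.symm l) (finProdFinEquiv.symm k) ↔
      ChainStep τ (finProdFinEquiv.symm l) (finProdFinEquiv.symm k) := by
    refine exists_congr fun i => and_congr_right fun _ => and_congr_right fun hi => ?_
    rw [← Equiv.symm_apply_eq, ← Equiv.symm_apply_eq, h2 i hi]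
  simp only [chainHamiltonian_apply, e1, e2]

/-- The vertices where the partly redirected chain differs from the fully redirected one lie on the
hidden part of the path, or are joined to it in the chain `B`. -/
theorem exists_of_row_ne {r : ℕ} {B : PermChain n T} {x : Fin (T - 1) → Fin (2 ^ n)}
    {k : Fin (T * 2 ^ n)}
    (h : chainHamiltonian (redirect B x) k ≠ chainHamiltonian (redirectUpTo (r + 1) B x) k) :
    (∃ m : Fin (T - 1), r ≤ m ∧ (m : ℕ) + 1 = (finProdFinEquiv.symm k).1 ∧
      x m = (finProdFinEquiv.symm k).2) ∨
    (∃ m : Fin (T - 1), r ≤ m ∧ (m : ℕ) + 0 = (finProdFinEquiv.symm k).1 ∧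
      x m = B m (finProdFinEquiv.symm k).2) ∨
    (∃ m : Fin (T - 1), r ≤ m ∧ (m : ℕ) + 2 = (finProdFinEquiv.symm k).1 ∧
      x m = if hm : (m : ℕ) + 1 < T - 1 then
        (B ⟨m + 1, hm⟩).symm (finProdFinEquiv.symm k).2 else 0) := by
  by_contra! hn
  obtain ⟨hn1, hn2, hn3⟩ := hn
  -- for `i ≥ r + 1`, the transposition in the definition of `redirect` must move an endpoint of an
  -- edge at `k`; the target `x (i - 1)` is hidden as well, since `i - 1 ≥ r`
  refine h (chainHamiltonian_row_congr k (fun i hi => ?_) fun i hi => ?_)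
  · rw [redirectUpTo]
    split_ifs with hir
    · rfl
    · obtain ⟨j, hj⟩ : ∃ j, (i : ℕ) = j + 1 := ⟨i - 1, by omega⟩
      have hjT : j < T - 1 := by have := i.2; omega
      have ht : targetPath x i = x ⟨j, hjT⟩ := by rw [hj, targetPath, dif_pos hjT]
      rw [redirect, Equiv.Perm.mul_apply, ht]
      refine Equiv.swap_apply_of_ne_of_ne ?_ ?_
      · exact fun he => hn1 ⟨j, hjT⟩ (by simp only; omega) (by simp only; omega)
          ((B i).injective he).symm
      · exact fun he => hn2 i (by omega) (by omega) he.symm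
  · rw [redirectUpTo]
    split_ifs with hir
    · rfl
    · obtain ⟨j, hj⟩ : ∃ j, (i : ℕ) = j + 1 := ⟨i - 1, by omega⟩
      have hjT : j < T - 1 := by have := i.2; omega
      have ht : targetPath x i = x ⟨j, hjT⟩ := by rw [hj, targetPath, dif_pos hjT]
      rw [redirect, ht]
      have he : (Equiv.swap (B i (x ⟨j, hjT⟩)) (x i) * B i).symm =
          (B i).symm * Equiv.swap (B i (x ⟨j, hjT⟩)) (x i) := by
        ext v; rfl
      rw [he, Equiv.Perm.mul_apply, Equiv.swap_apply_of_ne_of_ne]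
      · intro he
        have h3 := hn3 ⟨j, hjT⟩ (by simp only; omega) (by simp only; omega)
        have hi' : (⟨j + 1, by have := i.2; omega⟩ : Fin (T - 1)) = i := Fin.ext hj.symm
        rw [dif_pos (show j + 1 < T - 1 by have := i.2; omega), hi', he,
          Equiv.symm_apply_apply] at h3
        exact h3 rfl
      · exact fun he => hn1 i (by omega) (by omega) he.symm

open Classical in
/-- A fixed row of the Hamiltonian is changed by hiding the path with probability at most
`3 * 2 ^ (-n)`, even conditioned on the part of the path that has been revealed before. -/
theorem sum_row_ne_le (r : ℕ) (B : PermChain n T) (k : Fin (T * 2 ^ n))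
    (F : (Fin (T - 1) → Fin (2 ^ n)) → ℝ) (hF0 : ∀ x, 0 ≤ F x)
    (hF : ∀ x x', (∀ m : Fin (T - 1), (m : ℕ) < r → x m = x' m) → F x = F x') :
    2 ^ n * ∑ x, (if chainHamiltonian (redirect B x) k ≠
      chainHamiltonian (redirectUpTo (r + 1) B x) k then F x else 0) ≤ 3 * ∑ x, F x := by
  set j : ℕ := ((finProdFinEquiv.symm k).1 : ℕ) with hj
  set v := (finProdFinEquiv.symm k).2 with hv
  have h1 := sum_coincidence_le (r := r) (a := 1) (j := j) (fun _ => v) F hF0 hF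
    (fun x => ∃ m : Fin (T - 1), r ≤ m ∧ (m : ℕ) + 1 = j ∧ x m = v) fun x h => h
  have h2 := sum_coincidence_le (r := r) (a := 0) (j := j) (fun m => B m v) F hF0 hF
    (fun x => ∃ m : Fin (T - 1), r ≤ m ∧ (m : ℕ) + 0 = j ∧ x m = B m v) fun x h => h
  have h3 := sum_coincidence_le (r := r) (a := 2) (j := j)
    (fun m => if hm : (m : ℕ) + 1 < T - 1 then (B ⟨m + 1, hm⟩).symm v else 0) F hF0 hF
    (fun x => ∃ m : Fin (T - 1), r ≤ m ∧ (m : ℕ) + 2 = j ∧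
      x m = if hm : (m : ℕ) + 1 < T - 1 then (B ⟨m + 1, hm⟩).symm v else 0) fun x h => h
  have h4 : ∑ x, (if chainHamiltonian (redirect B x) k ≠
      chainHamiltonian (redirectUpTo (r + 1) B x) k then F x else 0) ≤
      ∑ x, (if ∃ m : Fin (T - 1), r ≤ m ∧ (m : ℕ) + 1 = j ∧ x m = v then F x else 0) +
      ∑ x, (if ∃ m : Fin (T - 1), r ≤ m ∧ (m : ℕ) + 0 = j ∧ x m = B m v then F x else 0) +
      ∑ x, (if ∃ m : Fin (T - 1), r ≤ m ∧ (m : ℕ) + 2 = j ∧ x m =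
        (if hm : (m : ℕ) + 1 < T - 1 then (B ⟨m + 1, hm⟩).symm v else 0) then F x else 0) := by
    rw [← Finset.sum_add_distrib, ← Finset.sum_add_distrib]
    refine Finset.sum_le_sum fun x _ => ?_
    have h0 := hF0 x
    by_cases hne : chainHamiltonian (redirect B x) k ≠
        chainHamiltonian (redirectUpTo (r + 1) B x) k
    · rw [if_pos hne]
      have hor := exists_of_row_ne hne
      rw [← hj, ← hv] at hor
      rcases hor with h | h | h
      · rw [if_pos h]
        split_ifs <;> linarith
      · rw [if_pos h]
        split_ifs <;> linarith
      · rw [if_pos h]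
        split_ifs <;> linarith
    · rw [if_neg hne]
      split_ifs <;> linarith
  have hN : (0 : ℝ) < 2 ^ n := by positivity
  have h5 := mul_le_mul_of_nonneg_left h4 hN.le
  rw [mul_add, mul_add] at h5
  linarith

end Hidden

namespace QueryAlgorithm

variable {n T p b : ℕ} (A : QueryAlgorithm (T * 2 ^ n) p b) (enc : ℂ → Fin b → ZMod 2)

/-- The state after `r` rounds if each round uses the chain in which the path is revealed by one
more vertex than in the round before. -/
def revealState (B : PermChain n T) (x : Fin (T - 1) → Fin (2 ^ n)) (r : ℕ) :
    MemoryBasis (T * 2 ^ n) p b A.work → ℂ :=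
  A.hybridState enc (fun s => chainHamiltonian (redirectUpTo (s + 1) B x)) (zeroState _) r

theorem revealState_congr (B : PermChain n T) {x x' : Fin (T - 1) → Fin (2 ^ n)} {r : ℕ}
    (h : ∀ m : Fin (T - 1), (m : ℕ) < r → x m = x' m) :
    A.revealState enc B x r = A.revealState enc B x' r :=
  A.hybridState_congr enc _ r fun s hs => by
    rw [redirectUpTo_congr B fun m hm => h m (by omega)]

theorem ampNorm_zeroState_le (N : ℕ) : ampNorm (zeroState N) ≤ 1 := by
  refine Real.sqrt_le_one.2 ?_
  have h : ∀ k : Fin N, ‖zeroState N k‖ ^ 2 = if (k : ℕ) = 0 then 1 else 0 := fun k => by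
    rw [zeroState]; split_ifs <;> simp
  rw [Finset.sum_congr rfl fun k _ => h k, Finset.sum_boole]
  have : (Finset.univ.filter fun k : Fin N => (k : ℕ) = 0).card ≤ 1 :=
    Finset.card_le_one.2 fun a ha b hb => Fin.ext (by
      rw [(Finset.mem_filter.1 ha).2, (Finset.mem_filter.1 hb).2])
  exact_mod_cast this

theorem sum_norm_sq_revealState_le (B : PermChain n T) (x : Fin (T - 1) → Fin (2 ^ n)) (r : ℕ) :
    ∑ m, ‖A.revealState enc B x r m‖ ^ 2 ≤ 1 := by
  rw [← ampNorm_sq, revealState, ampNorm_hybridState]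
  exact pow_le_one₀ (Real.sqrt_nonneg _) (ampNorm_zeroState_le _)

/-- Summed over the targets, the final state of the hybrid run has little weight on the hidden part
of the path. -/
theorem sum_reveal_beyond_le (B : PermChain n T) (q : ℕ) :
    2 ^ n * ∑ x, ampNorm (ampOn (fun m => m.1 ∈ pathBeyond (redirect B x) q)
      (A.revealState enc B x q)) ^ 2 ≤
      Fintype.card (Fin (T - 1) → Fin (2 ^ n)) := by
  classical
  have h1 : ∀ m : MemoryBasis (T * 2 ^ n) p b A.work,
      2 ^ n * ∑ x, (if m.1 ∈ pathBeyond (redirect B x) q then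
        ‖A.revealState enc B x q m‖ ^ 2 else 0) ≤ ∑ x, ‖A.revealState enc B x q m‖ ^ 2 :=
    fun m => by
      refine sum_coincidence_le (r := q) (a := 1) (j := (finProdFinEquiv.symm m.1).1)
        (fun _ => (finProdFinEquiv.symm m.1).2) _ (fun x => sq_nonneg _)
        (fun x x' h => by rw [A.revealState_congr enc B h]) _ fun x hx => ?_
      obtain ⟨-, h1, h2⟩ := Finset.mem_filter.1 hx
      rw [chainPath_redirect] at h2
      obtain ⟨j, hj⟩ : ∃ j, ((finProdFinEquiv.symm m.1).1 : ℕ) = j + 1 :=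
        ⟨(finProdFinEquiv.symm m.1).1 - 1, by omega⟩
      have hjT : j < T - 1 := by have := (finProdFinEquiv.symm m.1).1.2; omega
      refine ⟨⟨j, hjT⟩, by simp only; omega, hj.symm, ?_⟩
      rw [h2, hj, targetPath, dif_pos hjT]
  simp only [ampNorm_ampOn_sq]
  rw [Finset.sum_comm, Finset.mul_sum]
  refine (Finset.sum_le_sum fun m _ => h1 m).trans ?_
  rw [Finset.sum_comm]
  refine (Finset.sum_le_sum fun x _ => A.sum_norm_sq_revealState_le enc B x q).trans ?_
  simp

/-- Summed over the targets, the queries of one round of the hybrid run have little weight on the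
places where the oracle of this round differs from the true one. -/
theorem sum_reveal_changed_le (B : PermChain n T) (r : ℕ) :
    2 ^ n * ∑ x, ampNorm (ampOn (fun m => parallelOracle p A.work enc
        (chainHamiltonian (redirect B x)) m ≠
        parallelOracle p A.work enc (chainHamiltonian (redirectUpTo (r + 1) B x)) m)
      (A.revealState enc B x r)) ^ 2 ≤
      3 * p * Fintype.card (Fin (T - 1) → Fin (2 ^ n)) := by
  classical
  have h1 : ∀ (m : MemoryBasis (T * 2 ^ n) p b A.work) (i : Fin p),
      2 ^ n * ∑ x, (if ∃ u, slotRow (m.2.1 i) = some u ∧ chainHamiltonian (redirect B x) u ≠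
        chainHamiltonian (redirectUpTo (r + 1) B x) u then
        ‖A.revealState enc B x r m‖ ^ 2 else 0) ≤
          3 * ∑ x, ‖A.revealState enc B x r m‖ ^ 2 := fun m i => by
    rcases hs : slotRow (m.2.1 i) with _ | u
    · simp only [reduceCtorEq, false_and, exists_false, if_false, Finset.sum_const_zero, mul_zero]
      positivity
    · have h2 := sum_row_ne_le r B u (fun x => ‖A.revealState enc B x r m‖ ^ 2)
        (fun x => sq_nonneg _) fun x x' h => by rw [A.revealState_congr enc B h]
      simpa only [Option.some.injEq, exists_eq_left'] using h2
  have h3 : ∀ (x : Fin (T - 1) → Fin (2 ^ n)) (m : MemoryBasis (T * 2 ^ n) p b A.work),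
      (if parallelOracle p A.work enc (chainHamiltonian (redirect B x)) m ≠
        parallelOracle p A.work enc (chainHamiltonian (redirectUpTo (r + 1) B x)) m then
        ‖A.revealState enc B x r m‖ ^ 2 else 0) ≤
      ∑ i, if ∃ u, slotRow (m.2.1 i) = some u ∧ chainHamiltonian (redirect B x) u ≠
        chainHamiltonian (redirectUpTo (r + 1) B x) u then
        ‖A.revealState enc B x r m‖ ^ 2 else 0 := fun x m => by
    have hnn : ∀ i ∈ (Finset.univ : Finset (Fin p)), 0 ≤
        if ∃ u, slotRow (m.2.1 i) = some u ∧ chainHamiltonian (redirect B x) u ≠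
        chainHamiltonian (redirectUpTo (r + 1) B x) u then
        ‖A.revealState enc B x r m‖ ^ 2 else 0 := fun i _ => by split_ifs <;> positivity
    by_cases hne : parallelOracle p A.work enc (chainHamiltonian (redirect B x)) m ≠
        parallelOracle p A.work enc (chainHamiltonian (redirectUpTo (r + 1) B x)) m
    · obtain ⟨i, hi⟩ := exists_slotRow_of_parallelOracle_ne enc hne
      rw [if_pos hne]
      refine le_trans ?_ (Finset.single_le_sum hnn (Finset.mem_univ i))
      rw [if_pos hi]
    · rw [if_neg hne]
      exact Finset.sum_nonneg hnn
  simp only [ampNorm_ampOn_sq]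
  have hN : (0 : ℝ) < 2 ^ n := by positivity
  calc _ ≤ 2 ^ n * ∑ x : Fin (T - 1) → Fin (2 ^ n),
        ∑ m : MemoryBasis (T * 2 ^ n) p b A.work, ∑ i : Fin p,
        (if ∃ u, slotRow (m.2.1 i) = some u ∧ chainHamiltonian (redirect B x) u ≠
        chainHamiltonian (redirectUpTo (r + 1) B x) u then
        ‖A.revealState enc B x r m‖ ^ 2 else 0) := by
        refine mul_le_mul_of_nonneg_left ?_ hN.le
        exact Finset.sum_le_sum fun x _ => Finset.sum_le_sum fun m _ => h3 x m
    _ = ∑ m : MemoryBasis (T * 2 ^ n) p b A.work, ∑ i : Fin p,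
        2 ^ n * ∑ x : Fin (T - 1) → Fin (2 ^ n),
        (if ∃ u, slotRow (m.2.1 i) = some u ∧ chainHamiltonian (redirect B x) u ≠
        chainHamiltonian (redirectUpTo (r + 1) B x) u then
        ‖A.revealState enc B x r m‖ ^ 2 else 0) := by
        rw [Finset.sum_comm, Finset.mul_sum]
        refine Finset.sum_congr rfl fun m _ => ?_
        rw [Finset.sum_comm, Finset.mul_sum]
    _ ≤ ∑ m : MemoryBasis (T * 2 ^ n) p b A.work, ∑ i : Fin p,
        3 * ∑ x, ‖A.revealState enc B x r m‖ ^ 2 :=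
        Finset.sum_le_sum fun m _ => Finset.sum_le_sum fun i _ => h1 m i
    _ = 3 * p * ∑ x, ∑ m, ‖A.revealState enc B x r m‖ ^ 2 := by
        simp only [Finset.sum_const, Finset.card_univ, Fintype.card_fin, nsmul_eq_mul]
        rw [Finset.sum_comm, Finset.mul_sum]
        exact Finset.sum_congr rfl fun m _ => by ring
    _ ≤ 3 * p * ∑ x : Fin (T - 1) → Fin (2 ^ n), 1 := by
        gcongr with x
        exact A.sum_norm_sq_revealState_le enc B x r
    _ = _ := by simp

/-- Averaged over the chains, an algorithm ends on the path beyond the column whose number is the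
number of its rounds with a probability of the order of `2 ^ (-n)`. -/
theorem sum_prob_beyond_le :
    2 ^ n * ∑ σ : PermChain n T, ampNorm (ampOn (fun m => m.1 ∈ pathBeyond σ A.rounds)
      (A.stateAfter enc (chainHamiltonian σ) (zeroState _) A.rounds)) ^ 2 ≤
      (A.rounds + 1) * (12 * p * A.rounds + 1) * Fintype.card (PermChain n T) := by
  set q := A.rounds with hq
  set X := Fintype.card (Fin (T - 1) → Fin (2 ^ n)) with hX
  have hX0 : (0 : ℝ) < X := by
    rw [hX]; exact_mod_cast Fintype.card_pos
  have hN : (0 : ℝ) < 2 ^ n := by positivity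
  have h1 : ∀ B : PermChain n T, 2 ^ n * ∑ x, ampNorm (ampOn
      (fun m => m.1 ∈ pathBeyond (redirect B x) q)
      (A.stateAfter enc (chainHamiltonian (redirect B x)) (zeroState _) q)) ^ 2 ≤
      (q + 1) * (12 * p * q + 1) * X := fun B => by
    have h2 : ∀ x, _ := fun x => A.ampNorm_ampOn_stateAfter_sq_le enc
      (chainHamiltonian (redirect B x)) (fun s => chainHamiltonian (redirectUpTo (s + 1) B x))
      (zeroState _) q (fun m => m.1 ∈ pathBeyond (redirect B x) q)
    refine (mul_le_mul_of_nonneg_left (Finset.sum_le_sum fun x _ => h2 x) hN.le).trans ?_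
    rw [← Finset.mul_sum, Finset.sum_add_distrib, Finset.sum_comm]
    have h3 := A.sum_reveal_beyond_le enc B q
    have h4 : ∀ s ∈ Finset.range q, _ := fun s _ => A.sum_reveal_changed_le enc B s
    have h5 := Finset.sum_le_sum h4
    rw [Finset.sum_const, Finset.card_range, nsmul_eq_mul, ← Finset.mul_sum] at h5
    simp only [← Finset.mul_sum]
    simp only [revealState, ← hX] at h3 h5
    have hq0 : (0 : ℝ) < q + 1 := by positivity
    have h6 := mul_le_mul_of_nonneg_left (add_le_add (mul_le_mul_of_nonneg_left h5
      (by norm_num : (0 : ℝ) ≤ 4)) h3) hq0.le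
    refine le_trans (le_of_eq ?_) (h6.trans (le_of_eq ?_)) <;> ring
  have h7 := Finset.sum_le_sum fun (B : PermChain n T) (_ : B ∈ Finset.univ) => h1 B
  rw [← Finset.mul_sum, sum_redirect fun σ => ampNorm (ampOn (fun m => m.1 ∈ pathBeyond σ q)
      (A.stateAfter enc (chainHamiltonian σ) (zeroState _) q)) ^ 2, Finset.sum_const,
      Finset.card_univ, nsmul_eq_mul, ← hX] at h7
  refine le_of_mul_le_mul_left ?_ hX0
  refine le_trans (le_of_eq ?_) (h7.trans (le_of_eq ?_)) <;> ring

end QueryAlgorithm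

/-! ### From the hybrid bound to the simulation lower bound -/

theorem sum_norm_sq_zeroState {N : ℕ} (hN : 0 < N) : ∑ k, ‖zeroState N k‖ ^ 2 = 1 := by
  rw [Finset.sum_eq_single_of_mem (⟨0, hN⟩ : Fin N) (Finset.mem_univ _)]
  · simp [zeroState]
  · intro k _ hk
    have : (k : ℕ) ≠ 0 := fun h => hk (Fin.ext h)
    simp [zeroState, this]

theorem QueryAlgorithm.sum_output {N p b : ℕ} (A : QueryAlgorithm N p b)
    (enc : ℂ → Fin b → ZMod 2) (H : Matrix (Fin N) (Fin N) ℂ) (ψ : Fin N → ℂ)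
    (S : Finset (Fin N)) :
    ∑ k ∈ S, A.output enc H ψ k k =
      ((ampNorm (ampOn (fun m => m.1 ∈ S) (A.stateAfter enc H ψ A.rounds)) ^ 2 : ℝ) : ℂ) := by
  classical
  have h : ∀ k, A.output enc H ψ k k =
      ((∑ r, ‖A.stateAfter enc H ψ A.rounds (k, r)‖ ^ 2 : ℝ) : ℂ) := fun k => by
    rw [QueryAlgorithm.output, Matrix.of_apply]
    push_cast
    exact Finset.sum_congr rfl fun r _ => by rw [RCLike.star_def, Complex.mul_conj']
  rw [ampNorm_ampOn_sq, Fintype.sum_prod_type, Finset.sum_congr rfl fun k _ => h k,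
    ← Complex.ofReal_sum, ← Finset.univ_inter S, ← Finset.sum_ite_mem]
  congr 1
  refine Finset.sum_congr rfl fun k _ => ?_
  rw [Finset.univ_inter]
  split_ifs <;> simp

/-- A simulation with error at most `1 / 4` must end beyond the column `t / 100` of the path with
probability at least `1 / 50`. -/
theorem QueryAlgorithm.SimulatesOn.prob_beyond_ge {n T p b : ℕ}
    {A : QueryAlgorithm (T * 2 ^ n) p b} {enc : ℂ → Fin b → ZMod 2} {σ : PermChain n T} {t ε : ℝ}
    (ht : 100000 ≤ t) (hT : 2 * t ≤ T) (hε : ε ≤ 1 / 4) (hA : (A.rounds : ℝ) < 1 / 100 * t)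
    (h : A.SimulatesOn enc (chainHamiltonian σ) (zeroState _) t ε) :
    1 / 50 ≤ ampNorm (ampOn (fun m => m.1 ∈ pathBeyond σ A.rounds)
      (A.stateAfter enc (chainHamiltonian σ) (zeroState _) A.rounds)) ^ 2 := by
  have hT0 : 0 < T := by
    have : (0 : ℝ) < T := by linarith
    exact_mod_cast this
  have hN : 0 < T * 2 ^ n := by positivity
  set H := chainHamiltonian σ
  set φ := evolve H t (zeroState (T * 2 ^ n)) with hφ
  set S := pathBeyond σ A.rounds
  have hpure : ∀ S : Finset (Fin (T * 2 ^ n)),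
      ∑ k ∈ S, pureDensity φ k k = ((∑ k ∈ S, ‖φ k‖ ^ 2 : ℝ) : ℂ) := fun S => by
    push_cast
    refine Finset.sum_congr rfl fun k _ => ?_
    rw [pureDensity, Matrix.vecMulVec_apply, Pi.star_apply, RCLike.star_def, Complex.mul_conj']
  have htr : (A.output enc H (zeroState _) - pureDensity φ).trace = 0 := by
    have h1 := A.sum_output enc H (zeroState _) Finset.univ
    have h2 := hpure Finset.univ
    have h3 : ampNorm (ampOn (fun m => m.1 ∈ (Finset.univ : Finset (Fin (T * 2 ^ n))))
        (A.stateAfter enc H (zeroState _) A.rounds)) ^ 2 = 1 := by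
      have : ampOn (fun m => m.1 ∈ (Finset.univ : Finset (Fin (T * 2 ^ n))))
          (A.stateAfter enc H (zeroState _) A.rounds) =
          A.stateAfter enc H (zeroState _) A.rounds := by
        funext m; simp [ampOn]
      rw [this, ← A.hybridState_const, A.ampNorm_hybridState, ampNorm_sq,
        sum_norm_sq_zeroState hN]
    rw [h3] at h1
    rw [hφ, sum_norm_sq_evolve (chainHamiltonian_isHermitian σ), sum_norm_sq_zeroState hN] at h2
    rw [Matrix.trace_sub, Matrix.trace, Matrix.trace]
    simp only [Matrix.diag_apply]
    rw [h1, h2, sub_self]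
  have h1 := (norm_sum_diag_le_traceDistance _ _ htr S).trans (h.trans hε)
  simp only [Matrix.sub_apply] at h1
  rw [Finset.sum_sub_distrib, A.sum_output, hpure, ← Complex.ofReal_sub, Complex.norm_real,
    Real.norm_eq_abs, abs_le] at h1
  have h2 := prob_pathBeyond_ge σ ht hT hA
  linarith [h1.1]

/-- The bound for one algorithm and random permutations. -/
theorem uniformProb_simulatesOn_le {n T p b : ℕ} (A : QueryAlgorithm (T * 2 ^ n) p b)
    (enc : ℂ → Fin b → ZMod 2) {t ε : ℝ}
    (ht : 100000 ≤ t) (hT : t ≤ (T : ℝ) / 2) (hε : ε ≤ 1 / 4)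
    (hA : (A.rounds : ℝ) < 1 / 100 * t) :
    uniformProb (fun σ : PermChain n T =>
      A.SimulatesOn enc (chainHamiltonian σ) (zeroState _) t ε) ≤
      50 * ((T + 1) * (12 * p * T + 1)) * (2 ^ n)⁻¹ := by
  classical
  have hC : (0 : ℝ) < Fintype.card (PermChain n T) := by exact_mod_cast Fintype.card_pos
  have hN : (0 : ℝ) < 2 ^ n := by positivity
  have h1 := A.sum_prob_beyond_le enc
  set g : PermChain n T → ℝ := fun σ => ampNorm (ampOn (fun m => m.1 ∈ pathBeyond σ A.rounds)
    (A.stateAfter enc (chainHamiltonian σ) (zeroState _) A.rounds)) ^ 2 with hg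
  set E : PermChain n T → Prop := fun σ =>
    A.SimulatesOn enc (chainHamiltonian σ) (zeroState _) t ε with hE
  have h2 : ((Finset.univ.filter E).card : ℝ) * (1 / 50) ≤ ∑ σ, g σ := by
    rw [← nsmul_eq_mul, ← Finset.sum_const]
    refine (Finset.sum_le_sum fun σ hσ => ?_).trans
      (Finset.sum_le_sum_of_subset_of_nonneg (Finset.filter_subset E Finset.univ)
        fun σ _ _ => sq_nonneg _)
    exact (Finset.mem_filter.1 hσ).2.prob_beyond_ge ht (by linarith) hε hA
  have hq : (A.rounds : ℝ) ≤ T := by linarith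
  have h3 : ((A.rounds : ℝ) + 1) * (12 * p * A.rounds + 1) ≤ (T + 1) * (12 * p * T + 1) := by
    gcongr
  have h4 : 2 ^ n * (((Finset.univ.filter E).card : ℝ) * (1 / 50)) ≤
      (T + 1) * (12 * p * T + 1) * Fintype.card (PermChain n T) :=
    (mul_le_mul_of_nonneg_left h2 hN.le).trans
      (h1.trans (mul_le_mul_of_nonneg_right h3 hC.le))
  have h5 : uniformProb E = ((Finset.univ.filter E).card : ℝ) / Fintype.card (PermChain n T) := by
    rw [uniformProb]
  rw [h5, div_le_iff₀ hC, ← div_eq_mul_inv, div_mul_eq_mul_div, le_div_iff₀ hN]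
  linarith

open Polynomial in
theorem superpolynomialDecay_bound {T p : ℕ → ℕ} (hT : PolyBounded T) (hp : PolyBounded p) :
    Asymptotics.SuperpolynomialDecay Filter.atTop (fun n : ℕ => (n : ℝ))
      (fun n => 50 * (((T n : ℝ) + 1) * (12 * p n * T n + 1)) * ((2 : ℝ) ^ n)⁻¹) := by
  obtain ⟨a, ha⟩ := hT
  obtain ⟨c, hc⟩ := hp
  have h1 : Asymptotics.SuperpolynomialDecay Filter.atTop (fun n : ℕ => (n : ℝ))
      (fun n => ((2 : ℝ) ^ n)⁻¹) := fun k =>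
    tendsto_pow_const_div_const_pow_of_one_lt k (one_lt_two : (1 : ℝ) < 2)
  have h2 := h1.polynomial_mul
    (50 * (((X ^ a + (a : ℝ[X])) + 1) * (12 * (X ^ c + (c : ℝ[X])) * (X ^ a + (a : ℝ[X])) + 1)))
  refine h2.trans_eventually_abs_le (Filter.Eventually.of_forall fun n => ?_)
  have ha' : (T n : ℝ) ≤ (n : ℝ) ^ a + a := by exact_mod_cast ha n
  have hc' : (p n : ℝ) ≤ (n : ℝ) ^ c + c := by exact_mod_cast hc n
  simp only [Function.comp_apply, eval_mul, eval_add, eval_pow, eval_X,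
    eval_natCast, eval_one, eval_ofNat]
  rw [abs_of_nonneg (by positivity), abs_of_nonneg (by positivity)]
  gcongr

/-- The union bound: `k` events of probability at most `d < 1 / k` can be avoided. -/
theorem exists_forall_not_of_uniformProb_le {α : Type} [Fintype α] [Nonempty α] {k : ℕ} {d : ℝ}
    {E : ℕ → α → Prop} (hE : ∀ i < k, uniformProb (E i) ≤ d) (hd : k * d < 1) :
    ∃ a, ∀ i < k, ¬ E i a := by
  classical
  by_contra! hn
  have hC : (0 : ℝ) < Fintype.card α := by exact_mod_cast Fintype.card_pos
  have h1 : (Finset.univ : Finset α) ⊆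
      (Finset.range k).biUnion fun i => Finset.univ.filter (E i) := fun a _ => by
    obtain ⟨i, hi, ha⟩ := hn a
    simp only [Finset.mem_biUnion, Finset.mem_range, Finset.mem_filter, Finset.mem_univ, true_and]
    exact ⟨i, hi, ha⟩
  have h2 : (Fintype.card α : ℝ) ≤
      ∑ i ∈ Finset.range k, ((Finset.univ.filter (E i)).card : ℝ) := by
    exact_mod_cast (Finset.card_le_card h1).trans Finset.card_biUnion_le
  have h3 : ∑ i ∈ Finset.range k, ((Finset.univ.filter (E i)).card : ℝ) ≤
      ∑ i ∈ Finset.range k, d * Fintype.card α := by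
    refine Finset.sum_le_sum fun i hi => ?_
    have h4 := hE i (Finset.mem_range.1 hi)
    rw [uniformProb, div_le_iff₀ hC] at h4
    convert h4
  rw [Finset.sum_const, Finset.card_range, nsmul_eq_mul] at h3
  nlinarith

end

theorem mainTheorem1 :
    -- shape of the Hamiltonians, which are matrices of size `T * 2 ^ n`
    (∀ (n T : ℕ) (σ : PermChain n T),
      (chainHamiltonian σ).IsHermitian ∧ IsSparse 2 (chainHamiltonian σ) ∧
        ∀ j k, ‖chainHamiltonian σ j k‖ ≤ 1) ∧
    ∃ c : ℝ, 0 < c ∧ ∃ t₀ : ℝ, 0 < t₀ ∧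
      ∀ T p : ℕ → ℕ, PolyBounded T → PolyBounded p →
        -- uniformly random permutations, one algorithm
        (∃ δ : ℕ → ℝ,
          Asymptotics.SuperpolynomialDecay Filter.atTop (fun n : ℕ => (n : ℝ)) δ ∧
          ∀ (n b : ℕ) (enc : ℂ → Fin b → ZMod 2) (t ε : ℝ),
            t₀ ≤ t → t ≤ (T n : ℝ) / 2 → ε ≤ 1 / 4 →
            ∀ A : QueryAlgorithm (T n * 2 ^ n) (p n) b, (A.rounds : ℝ) < c * t →
              uniformProb (fun σ : PermChain n (T n) =>
                A.SimulatesOn enc (chainHamiltonian σ) (zeroState (T n * 2 ^ n)) t ε) ≤ δ n) ∧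
        -- one sequence of Hamiltonians, countably many algorithms
        (∀ (b : ℕ → ℕ) (enc : ∀ n, ℂ → Fin (b n) → ZMod 2)
          (A : ℕ → ∀ n, QueryAlgorithm (T n * 2 ^ n) (p n) (b n)) (t : ℕ → ℕ → ℝ),
          ∃ σ : ∀ n, PermChain n (T n), ∀ i, ∀ᶠ n in Filter.atTop,
            t₀ ≤ t i n → t i n ≤ (T n : ℝ) / 2 → ∀ ε : ℝ, ε ≤ 1 / 4 →
            (A i n).SimulatesOn (enc n) (chainHamiltonian (σ n))
              (zeroState (T n * 2 ^ n)) (t i n) ε →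
            c * t i n ≤ ((A i n).rounds : ℝ)) := by

  refine ⟨fun n T σ => ⟨chainHamiltonian_isHermitian σ, chainHamiltonian_isSparse σ,
    norm_chainHamiltonian_le σ⟩, 1 / 100, by norm_num, 100000, by norm_num,
    fun T p hT hp => ?_⟩
  have hδ := superpolynomialDecay_bound hT hp
  set δ : ℕ → ℝ := fun n => 50 * (((T n : ℝ) + 1) * (12 * p n * T n + 1)) * ((2 : ℝ) ^ n)⁻¹
  have hδ0 : ∀ n, 0 ≤ δ n := fun n => by positivity
  refine ⟨⟨δ, hδ, fun n b enc t ε ht htT hε A hA =>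
    uniformProb_simulatesOn_le A enc ht htT hε hA⟩, fun b enc A t => ?_⟩
  -- the event that the `i`-th algorithm simulates with too few rounds
  set E : ∀ n, ℕ → PermChain n (T n) → Prop := fun n i σ =>
    100000 ≤ t i n ∧ t i n ≤ (T n : ℝ) / 2 ∧ ((A i n).rounds : ℝ) < 1 / 100 * t i n ∧
      (A i n).SimulatesOn (enc n) (chainHamiltonian σ) (zeroState _) (t i n) (1 / 4) with hE
  have hprob : ∀ n i, uniformProb (E n i) ≤ δ n := fun n i => by
    by_cases h : 100000 ≤ t i n ∧ t i n ≤ (T n : ℝ) / 2 ∧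
        ((A i n).rounds : ℝ) < 1 / 100 * t i n
    · have : E n i = fun σ => (A i n).SimulatesOn (enc n) (chainHamiltonian σ) (zeroState _)
          (t i n) (1 / 4) := by
        funext σ
        simp only [hE, h.1, h.2.1, h.2.2, true_and]
      rw [this]
      exact uniformProb_simulatesOn_le (A i n) (enc n) h.1 h.2.1 le_rfl h.2.2
    · have : E n i = fun _ => False := by
        funext σ
        exact eq_false fun hσ => h ⟨hσ.1, hσ.2.1, hσ.2.2.1⟩
      rw [this]
      simpa [uniformProb] using hδ0 n
  have hex : ∀ n, ∃ σ : PermChain n (T n), (n : ℝ) * δ n < 1 → ∀ i < n, ¬ E n i σ := fun n => by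
    by_cases h : (n : ℝ) * δ n < 1
    · obtain ⟨σ, hσ⟩ := exists_forall_not_of_uniformProb_le (fun i _ => hprob n i) h
      exact ⟨σ, fun _ => hσ⟩
    · exact ⟨fun _ => 1, fun h' => absurd h' h⟩
  choose σ hσ using hex
  refine ⟨σ, fun i => ?_⟩
  have hlim : Filter.Tendsto (fun n : ℕ => (n : ℝ) * δ n) Filter.atTop (nhds 0) := by
    simpa using hδ 1
  filter_upwards [hlim.eventually_lt_const one_pos, Filter.eventually_gt_atTop i]
    with n hn hin ht htT ε hε hsim
  by_contra hlt
  exact hσ n hn i hin ⟨ht, htT, not_le.1 hlt, le_trans hsim hε⟩
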